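/- Let $H$ be a compact simple Lie group with Lie algebra $\mathfrak h$ and Killing form $B_{\mathfrak h}$ (so $-B_{\mathfrak h}>0$), and let $H/K$ be a symmetric space: $\mathfrak h=\mathfrak k\oplus\mathfrak q$, where the Lie algebra $\mathfrak k$ of $K$ and $\mathfrak q$ are the $(+1)$- and $(-1)$-eigenspaces of an involutive automorphism $\theta\neq\mathrm{id}$ of $\mathfrak h$ (then $H/K$ is irreducible). Put $G=H\times H$, $\Delta K=\{(k,k):k\in K\}$, $M=G/\Delta K$, and $$\mathfrak g=\mathfrak h\oplus\mathfrak h=\Delta\mathfrak k\oplus\mathfrak p,\qquad \mathfrak p=\mathfrak p_1\oplus\mathfrak p_2\oplus\mathfrak p_3,\quad \mathfrak p_1=(\mathfrak q,0),\ \mathfrak p_2=(0,\mathfrak q),\ \mathfrak p_3=\{(Z,-Z):Z\in\mathfrak k\}.$$ $G$-invariant metrics on $M$ are identified with isotropy-invariant inner products on $\mathfrak p\cong T_oM$. For $x_1,x_2,x_3>0$ and $x_1x_2>x_4^2$ let $g=(x_1,x_2,x_3,x_4)$ be the $G$-invariant metric for which $\mathfrak p_1\oplus\mathfrak p_2\perp\mathfrak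 p_3$ and, for $X_i,Y_i\in\mathfrak q$ and $Z,W\in\mathfrak k$, $$g((X_1,X_2),(Y_1,Y_2))=-x_1B_{\mathfrak h}(X_1,Y_1)-x_2B_{\mathfrak h}(X_2,Y_2)-x_4\big(B_{\mathfrak h}(X_1,Y_2)+B_{\mathfrak h}(X_2,Y_1)\big),$$ $$g((Z,-Z),(W,-W))=-2x_3B_{\mathfrak h}(Z,W).$$ Let $\mathcal M^4$ be the set of these metrics, $\mathcal M^4_1\subset\mathcal M^4$ the submanifold of those of unit volume, and $\mathrm{Sc}:\mathcal M^4_1\to\mathbb R$ the scalar curvature. At a critical point $g$ of $\mathrm{Sc}$ on $\mathcal M^4_1$ let $\mathrm{Sc}''_g$ be the symmetric bilinear form on $T_g\mathcal M^4_1$ with $\mathrm{Sc}''_g(T,T)=\frac{d^2}{dt^2}\big|_{0}\mathrm{Sc}(\gamma(t))$ for every smooth curve $\gamma$ in $\mathcal M^4_1$ with $\gamma(0)=g$, $\gamma'(0)=T$. Then $g$ is called non-degenerate if $\mathrm{Sc}''_g$ is non-degenerate, $G$-unstable if $\mathrm{Sc}''_g(T,T)>0$ for some $T\in T_g\mathcal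 M^4_1$, and its coindex is the maximal dimension of a subspace of $T_g\mathcal M^4_1$ on which $\mathrm{Sc}''_g$ is positive definite. **Theorem.** 1. The unit volume multiple of $g_5=\left(\tfrac12,\tfrac32,1,\tfrac12\right)$ is an Einstein metric and a critical point of $\mathrm{Sc}$ on $\mathcal M^4_1$ that is non-degenerate and $G$-unstable, with coindex $1$. 2. If $B_{\mathfrak k}=a\,B_{\mathfrak h}|_{\mathfrak k\times\mathfrak k}$ with $a>\tfrac12$, where $B_{\mathfrak k}$ is the Killing form of $\mathfrak k$, then the unit volume multiple of $g_3=(1,1,1,y_+)$, $y_+=\tfrac12\sqrt{\tfrac{2a-1}{2-a}}$, is an Einstein metric and a critical point of $\mathrm{Sc}$ on $\mathcal M^4_1$ that is non-degenerate and $G$-unstable, with coindex $2$. -/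

import Mathlib

open Filter Topology
open scoped ContDiff

/-! ### Reductive homogeneous spaces and the curvature of their invariant metrics -/

/-- The infinitesimal data of a reductive homogeneous space `M = G/L`: the Lie algebra `𝔤` of `G`,
the isotropy subalgebra `𝔩` (the Lie algebra of `L`) and an `ad 𝔩`-invariant complement `𝔭`, which
is identified with the tangent space of `M` at the base point. -/
structure ReductiveSpace (𝔤 : Type*) [LieRing 𝔤] [LieAlgebra ℝ 𝔤] where
  /-- the isotropy subalgebra `𝔩` -/
  isotropy : LieSubalgebra ℝ 𝔤
  /-- the reductive complement `𝔭` -/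
  compl : Submodule ℝ 𝔤
  isCompl : IsCompl isotropy.toSubmodule compl
  lie_mem : ∀ Z ∈ isotropy, ∀ X ∈ compl, ⁅Z, X⁆ ∈ compl

namespace ReductiveSpace

variable {𝔤 : Type*} [LieRing 𝔤] [LieAlgebra ℝ 𝔤] (R : ReductiveSpace 𝔤)

/-- The projection `𝔤 = 𝔩 ⊕ 𝔭 → 𝔭`. -/
noncomputable def toCompl : 𝔤 →ₗ[ℝ] R.compl :=
  R.compl.projectionOnto R.isotropy.toSubmodule R.isCompl.symm

/-- The projection `𝔤 = 𝔩 ⊕ 𝔭 → 𝔩`. -/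
noncomputable def toIsotropy : 𝔤 →ₗ[ℝ] R.isotropy.toSubmodule :=
  R.isotropy.toSubmodule.projectionOnto R.compl R.isCompl

/-- The isotropy representation of `𝔩` on `𝔭`: `Z ↦ (X ↦ [Z, X])`. -/
def isotropyRep : R.isotropy.toSubmodule →ₗ[ℝ] Module.End ℝ R.compl :=
  LinearMap.mk₂ ℝ (fun Z X => ⟨⁅(Z : 𝔤), (X : 𝔤)⁆, R.lie_mem Z Z.2 X X.2⟩)
    (fun _ _ _ => Subtype.ext (by simp)) (fun _ _ _ => Subtype.ext (by simp))
    (fun _ _ _ => Subtype.ext (by simp)) (fun _ _ _ => Subtype.ext (by simp))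

/-- The bracket of `𝔤` restricted to `𝔭`, with values in `𝔤`. -/
def lieCompl : R.compl →ₗ[ℝ] R.compl →ₗ[ℝ] 𝔤 :=
  LinearMap.mk₂ ℝ (fun X Y => ⁅(X : 𝔤), (Y : 𝔤)⁆)
    (fun _ _ _ => by simp) (fun _ _ _ => by simp) (fun _ _ _ => by simp) (fun _ _ _ => by simp)

/-- The `𝔭`-component `[X, Y]_𝔭` of the bracket of `X, Y ∈ 𝔭`. -/
noncomputable def bracketCompl : R.compl →ₗ[ℝ] R.compl →ₗ[ℝ] R.compl :=
  R.lieCompl.compr₂ R.toCompl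

/-- The endomorphism `W ↦ [[X, Y]_𝔩, W]` of `𝔭`, for `X, Y ∈ 𝔭`. -/
noncomputable def bracketIsotropy : R.compl →ₗ[ℝ] R.compl →ₗ[ℝ] Module.End ℝ R.compl :=
  R.lieCompl.compr₂ (R.isotropyRep ∘ₗ R.toIsotropy)

/-- A `G`-invariant Riemannian metric on `G/L`, i.e. an inner product on `𝔭` that is invariant
under the isotropy representation. -/
structure InvariantMetric where
  /-- the inner product on `𝔭` -/
  form : LinearMap.BilinForm ℝ R.compl
  symm : ∀ X Y, form X Y = form Y X
  pos : ∀ X, X ≠ 0 → 0 < form X X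
  invariant : ∀ Z X Y, form (R.isotropyRep Z X) Y + form X (R.isotropyRep Z Y) = 0

namespace InvariantMetric

variable {R} (g : R.InvariantMetric)

theorem nondegenerate : g.form.Nondegenerate := by
  refine ⟨fun X h => ?_, fun X h => ?_⟩ <;>
  · by_contra hX
    exact (g.pos X hX).ne' (h X)

variable [FiniteDimensional ℝ 𝔤]

/-- The musical isomorphism `𝔭* → 𝔭` of the metric. -/
noncomputable def sharp : Module.Dual ℝ R.compl →ₗ[ℝ] R.compl :=
  (LinearMap.BilinForm.toDual g.form g.nondegenerate).symm.toLinearMap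

/-- The linear functional
`W ↦ g([X, Y]_𝔭, W) + g([W, X]_𝔭, Y) + g(X, [W, Y]_𝔭)` on `𝔭`, as a bilinear map in `X, Y`. -/
noncomputable def koszul : R.compl →ₗ[ℝ] R.compl →ₗ[ℝ] Module.Dual ℝ R.compl :=
  LinearMap.mk₂ ℝ
    (fun X Y => g.form (R.bracketCompl X Y) + g.form.flip Y ∘ₗ R.bracketCompl.flip X
      + g.form X ∘ₗ R.bracketCompl.flip Y)
    (fun _ _ _ => by ext; simp; ring) (fun _ _ _ => by ext; simp; try ring)
    (fun _ _ _ => by ext; simp; ring) (fun _ _ _ => by ext; simp; try ring)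

/-- The Levi-Civita connection of the invariant metric `g` at the base point, as the linear map
`Λ : 𝔭 → gl(𝔭)` given by the Koszul formula
`2 g(Λ_X Y, W) = g([X, Y]_𝔭, W) + g([W, X]_𝔭, Y) + g(X, [W, Y]_𝔭)`. -/
noncomputable def leviCivita : R.compl →ₗ[ℝ] Module.End ℝ R.compl :=
  g.koszul.compr₂ ((1 / 2 : ℝ) • g.sharp)

/-- The Riemann curvature tensor at the base point,
`R(X, Y) = [Λ_X, Λ_Y] - Λ_{[X, Y]_𝔭} - ad [X, Y]_𝔩`, as an endomorphism of `𝔭`. -/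
noncomputable def curvature : R.compl →ₗ[ℝ] R.compl →ₗ[ℝ] Module.End ℝ R.compl :=
  LinearMap.mk₂ ℝ
    (fun X Y => g.leviCivita X * g.leviCivita Y - g.leviCivita Y * g.leviCivita X
      - g.leviCivita (R.bracketCompl X Y) - R.bracketIsotropy X Y)
    (fun _ _ _ => by simp only [map_add, LinearMap.add_apply, add_mul, mul_add]; abel)
    (fun _ _ _ => by simp only [map_smul, LinearMap.smul_apply, smul_mul_assoc, mul_smul_comm,
      smul_sub])
    (fun _ _ _ => by simp only [map_add, add_mul, mul_add]; abel)
    (fun _ _ _ => by simp only [map_smul, smul_mul_assoc, mul_smul_comm, smul_sub])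

theorem curvature_apply (X Y W : R.compl) :
    g.curvature X Y W = g.leviCivita X (g.leviCivita Y W) - g.leviCivita Y (g.leviCivita X W)
      - g.leviCivita (R.bracketCompl X Y) W - R.bracketIsotropy X Y W := rfl

/-- The Ricci tensor `ric(X, Y) = tr (W ↦ R(W, X) Y)`. -/
noncomputable def ricci : LinearMap.BilinForm ℝ R.compl :=
  LinearMap.mk₂ ℝ
    (fun X Y => LinearMap.trace ℝ R.compl ((g.curvature.flip X).flip Y))
    (fun X X' Y => by rw [← map_add]; congr 1; ext; simp)
    (fun c X Y => by rw [← map_smul]; congr 1; ext; simp)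
    (fun X Y Y' => by rw [← map_add]; congr 1; ext; simp)
    (fun c X Y => by rw [← map_smul]; congr 1; ext; simp)

/-- The scalar curvature: the trace of the Ricci tensor with respect to `g`. -/
noncomputable def scalarCurvature : ℝ :=
  LinearMap.trace ℝ R.compl (g.sharp ∘ₗ g.ricci)

/-- `g` is an Einstein metric: `ric = c g` for a constant `c`. -/
def IsEinstein : Prop := ∃ c : ℝ, g.ricci = c • g.form

/-- The determinant `det_{g₀} g` of `g` with respect to a background metric `g₀`. -/
noncomputable def detRel (g₀ g : R.InvariantMetric) : ℝ :=
  LinearMap.det (g₀.sharp ∘ₗ g.form)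

end InvariantMetric

end ReductiveSpace

/-! ### The homogeneous space `H × H / ΔK` of a symmetric space `H / K` -/

/-- The infinitesimal data of a symmetric space `H/K` with `H` compact simple: a simple real Lie
algebra `𝔥` with negative definite Killing form, and a non-trivial involutive automorphism `θ`.
Such a symmetric space is irreducible. -/
structure SymmetricPair (𝔥 : Type*) [LieRing 𝔥] [LieAlgebra ℝ 𝔥] [FiniteDimensional ℝ 𝔥] where
  simple : LieAlgebra.IsSimple ℝ 𝔥
  compact : ∀ X : 𝔥, X ≠ 0 → killingForm ℝ 𝔥 X X < 0
  /-- the involution -/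
  θ : 𝔥 →ₗ⁅ℝ⁆ 𝔥
  involutive : ∀ X, θ (θ X) = X
  nontrivial : ∃ X, θ X ≠ X

namespace SymmetricPair

variable {𝔥 : Type*} [LieRing 𝔥] [LieAlgebra ℝ 𝔥] [FiniteDimensional ℝ 𝔥] (S : SymmetricPair 𝔥)

/-- The Lie algebra `𝔨` of `K`: the fixed points of `θ`. -/
def 𝔨 : LieSubalgebra ℝ 𝔥 where
  carrier := {X | S.θ X = X}
  zero_mem' := by simp
  add_mem' := by
    intro X Y hX hY
    simp only [Set.mem_ofPred_eq] at *
    rw [map_add, hX, hY]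
  smul_mem' := by
    intro c X hX
    simp only [Set.mem_ofPred_eq] at *
    rw [map_smul, hX]
  lie_mem' := by
    intro X Y hX hY
    simp only [Set.mem_ofPred_eq] at *
    rw [LieHom.map_lie]
    exact congrArg₂ _ hX hY

/-- The complement `𝔮` of `𝔨`: the `(-1)`-eigenspace of `θ`. -/
def 𝔮 : Submodule ℝ 𝔥 where
  carrier := {X | S.θ X = -X}
  zero_mem' := by simp
  add_mem' := by
    intro X Y hX hY
    simp only [Set.mem_ofPred_eq] at *
    rw [map_add, hX, hY]
    abel
  smul_mem' := by
    intro c X hX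
    simp only [Set.mem_ofPred_eq] at *
    rw [map_smul, hX, smul_neg]

theorem mem_𝔨 {X : 𝔥} : X ∈ S.𝔨 ↔ S.θ X = X := Iff.rfl

theorem mem_𝔮 {X : 𝔥} : X ∈ S.𝔮 ↔ S.θ X = -X := Iff.rfl

/-- The projection of `𝔥 = 𝔨 ⊕ 𝔮` onto `𝔨`, as an endomorphism of `𝔥`. -/
noncomputable def projK : 𝔥 →ₗ[ℝ] 𝔥 := (1 / 2 : ℝ) • (LinearMap.id + (S.θ : 𝔥 →ₗ[ℝ] 𝔥))

/-- The projection of `𝔥 = 𝔨 ⊕ 𝔮` onto `𝔮`, as an endomorphism of `𝔥`. -/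
noncomputable def projQ : 𝔥 →ₗ[ℝ] 𝔥 := (1 / 2 : ℝ) • (LinearMap.id - (S.θ : 𝔥 →ₗ[ℝ] 𝔥))

theorem projK_apply (X : 𝔥) : S.projK X = (1 / 2 : ℝ) • (X + S.θ X) := rfl

theorem projQ_apply (X : 𝔥) : S.projQ X = (1 / 2 : ℝ) • (X - S.θ X) := rfl

theorem projK_add_projQ (X : 𝔥) : S.projK X + S.projQ X = X := by
  rw [projK_apply, projQ_apply]
  module

theorem projK_mem (X : 𝔥) : S.projK X ∈ S.𝔨 := by
  rw [mem_𝔨, projK_apply, map_smul, map_add, S.involutive, add_comm]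

theorem projQ_mem (X : 𝔥) : S.projQ X ∈ S.𝔮 := by
  rw [mem_𝔮, projQ_apply, map_smul, map_sub, S.involutive]
  module

theorem projK_of_mem {X : 𝔥} (hX : X ∈ S.𝔨) : S.projK X = X := by
  rw [mem_𝔨] at hX
  rw [projK_apply, hX]
  module

theorem projQ_of_mem {X : 𝔥} (hX : X ∈ S.𝔮) : S.projQ X = X := by
  rw [mem_𝔮] at hX
  rw [projQ_apply, hX]
  module

theorem projK_of_mem_𝔮 {X : 𝔥} (hX : X ∈ S.𝔮) : S.projK X = 0 := by
  rw [mem_𝔮] at hX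
  rw [projK_apply, hX]
  module

theorem projK_lie {Z : 𝔥} (hZ : Z ∈ S.𝔨) (X : 𝔥) : S.projK ⁅Z, X⁆ = ⁅Z, S.projK X⁆ := by
  rw [mem_𝔨] at hZ
  rw [projK_apply, projK_apply, LieHom.map_lie, hZ, lie_smul, lie_add]

theorem projQ_lie {Z : 𝔥} (hZ : Z ∈ S.𝔨) (X : 𝔥) : S.projQ ⁅Z, X⁆ = ⁅Z, S.projQ X⁆ := by
  rw [mem_𝔨] at hZ
  rw [projQ_apply, projQ_apply, LieHom.map_lie, hZ, lie_smul, lie_sub]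

/-- `𝔭₁ = (𝔮, 0)`. -/
def 𝔭₁ : Submodule ℝ (𝔥 × 𝔥) := S.𝔮.prod ⊥

/-- `𝔭₂ = (0, 𝔮)`. -/
def 𝔭₂ : Submodule ℝ (𝔥 × 𝔥) := (⊥ : Submodule ℝ 𝔥).prod S.𝔮

/-- `𝔭₃ = {(Z, -Z) : Z ∈ 𝔨}`. -/
def 𝔭₃ : Submodule ℝ (𝔥 × 𝔥) :=
  S.𝔨.toSubmodule.map (LinearMap.prod LinearMap.id (-LinearMap.id))

/-- The diagonal subalgebra `Δ𝔨 = {(Z, Z) : Z ∈ 𝔨}` of `𝔤 = 𝔥 ⊕ 𝔥`. -/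
def Δ𝔨 : LieSubalgebra ℝ (𝔥 × 𝔥) where
  carrier := {U | U.1 ∈ S.𝔨 ∧ U.2 = U.1}
  zero_mem' := ⟨S.𝔨.zero_mem, rfl⟩
  add_mem' := fun hU hV => ⟨S.𝔨.add_mem hU.1 hV.1, by simp [hU.2, hV.2]⟩
  smul_mem' := fun c _ hU => ⟨S.𝔨.smul_mem c hU.1, by simp [hU.2]⟩
  lie_mem' := fun {U V} hU hV => ⟨S.𝔨.lie_mem hU.1 hV.1, by
    change ⁅U.2, V.2⁆ = ⁅U.1, V.1⁆
    rw [hU.2, hV.2]⟩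

theorem mem_Δ𝔨 {U : 𝔥 × 𝔥} : U ∈ S.Δ𝔨 ↔ U.1 ∈ S.𝔨 ∧ U.2 = U.1 := Iff.rfl

theorem mem_𝔭 {U : 𝔥 × 𝔥} : U ∈ S.𝔭₁ ⊔ S.𝔭₂ ⊔ S.𝔭₃ ↔ S.projK U.2 = -S.projK U.1 := by
  constructor
  · intro h
    obtain ⟨V, hV, W, hW, rfl⟩ := Submodule.mem_sup.1 h
    obtain ⟨A, hA, B, hB, rfl⟩ := Submodule.mem_sup.1 hV
    obtain ⟨Z, hZ, rfl⟩ := hW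
    have hA1 := S.projK_of_mem_𝔮 hA.1
    have hA2 : A.2 = 0 := hA.2
    have hB1 : B.1 = 0 := hB.1
    have hB2 := S.projK_of_mem_𝔮 hB.2
    simp [hA1, hA2, hB1, hB2]
  · intro h
    refine Submodule.mem_sup.2 ⟨(S.projQ U.1, S.projQ U.2), Submodule.mem_sup.2
      ⟨(S.projQ U.1, 0), ⟨S.projQ_mem _, rfl⟩, (0, S.projQ U.2), ⟨rfl, S.projQ_mem _⟩, by simp⟩,
      (S.projK U.1, -S.projK U.1), ⟨S.projK U.1, S.projK_mem _, rfl⟩, ?_⟩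
    ext
    · simp only [Prod.fst_add]
      rw [add_comm, S.projK_add_projQ]
    · simp only [Prod.snd_add]
      rw [← h, add_comm, S.projK_add_projQ]

/-- The reductive homogeneous space `M = G/ΔK`, `G = H × H`, with `𝔤 = 𝔥 ⊕ 𝔥 = Δ𝔨 ⊕ 𝔭` and
`𝔭 = 𝔭₁ ⊕ 𝔭₂ ⊕ 𝔭₃`. -/
def M : ReductiveSpace (𝔥 × 𝔥) where
  isotropy := S.Δ𝔨
  compl := S.𝔭₁ ⊔ S.𝔭₂ ⊔ S.𝔭₃
  isCompl := by
    rw [isCompl_iff]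
    constructor
    · rw [Submodule.disjoint_def]
      intro U hU hU'
      rw [mem_𝔭] at hU'
      obtain ⟨h1, h2⟩ := S.mem_Δ𝔨.1 hU
      rw [h2, S.projK_of_mem h1] at hU'
      have h3 : U.1 = 0 := by
        have e : (2 : ℝ) • U.1 = 0 := by
          rw [two_smul]
          nth_rewrite 2 [hU']
          exact add_neg_cancel _
        exact (smul_eq_zero.1 e).resolve_left two_ne_zero
      exact Prod.ext h3 (h2.trans h3)
    · rw [codisjoint_iff_le_sup]
      intro U _
      have hZ : S.projK ((1 / 2 : ℝ) • (U.1 + U.2)) ∈ S.𝔨 := S.projK_mem _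
      refine Submodule.mem_sup.2 ⟨(S.projK ((1 / 2 : ℝ) • (U.1 + U.2)),
        S.projK ((1 / 2 : ℝ) • (U.1 + U.2))), ⟨hZ, rfl⟩,
        U - (S.projK ((1 / 2 : ℝ) • (U.1 + U.2)), S.projK ((1 / 2 : ℝ) • (U.1 + U.2))), ?_,
        by simp⟩
      rw [mem_𝔭]
      simp only [Prod.fst_sub, Prod.snd_sub, map_sub]
      rw [S.projK_of_mem hZ, map_smul, map_add]
      module
  lie_mem := by
    intro Z hZ X hX
    rw [mem_𝔭] at hX ⊢
    obtain ⟨h1, h2⟩ := S.mem_Δ𝔨.1 hZ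
    change S.projK ⁅Z.2, X.2⁆ = -S.projK ⁅Z.1, X.1⁆
    rw [h2, S.projK_lie h1, S.projK_lie h1, hX, lie_neg]

theorem mem_compl {U : 𝔥 × 𝔥} : U ∈ S.M.compl ↔ S.projK U.2 = -S.projK U.1 := S.mem_𝔭

/-- The inner product `-B_𝔥`, where `B_𝔥` is the Killing form of `𝔥`. -/
noncomputable def negB (_ : SymmetricPair 𝔥) : LinearMap.BilinForm ℝ 𝔥 := -killingForm ℝ 𝔥

/-- The symmetric bilinear form `(x₁, x₂, x₃, x₄)` on `𝔭`, with `x i` for `x_{i+1}`: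
for `X₁, X₂, Y₁, Y₂ ∈ 𝔮` and `Z, W ∈ 𝔨` it takes `(X₁ + Z, X₂ - Z)`, `(Y₁ + W, Y₂ - W)` to
`x₁ (-B)(X₁, Y₁) + x₂ (-B)(X₂, Y₂) + x₄ ((-B)(X₁, Y₂) + (-B)(X₂, Y₁)) + 2 x₃ (-B)(Z, W)`. -/
noncomputable def formM4 (x : Fin 4 → ℝ) : LinearMap.BilinForm ℝ S.M.compl :=
  let q₁ : S.M.compl →ₗ[ℝ] 𝔥 := S.projQ ∘ₗ LinearMap.fst ℝ 𝔥 𝔥 ∘ₗ S.M.compl.subtype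
  let q₂ : S.M.compl →ₗ[ℝ] 𝔥 := S.projQ ∘ₗ LinearMap.snd ℝ 𝔥 𝔥 ∘ₗ S.M.compl.subtype
  let k : S.M.compl →ₗ[ℝ] 𝔥 := S.projK ∘ₗ LinearMap.fst ℝ 𝔥 𝔥 ∘ₗ S.M.compl.subtype
  x 0 • S.negB.compl₁₂ q₁ q₁ + x 1 • S.negB.compl₁₂ q₂ q₂
    + x 3 • (S.negB.compl₁₂ q₁ q₂ + S.negB.compl₁₂ q₂ q₁)
    + (2 * x 2) • S.negB.compl₁₂ k k

theorem formM4_apply (x : Fin 4 → ℝ) (U V : S.M.compl) : S.formM4 x U V =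
    x 0 * S.negB (S.projQ U.1.1) (S.projQ V.1.1) + x 1 * S.negB (S.projQ U.1.2) (S.projQ V.1.2)
    + x 3 * (S.negB (S.projQ U.1.1) (S.projQ V.1.2) + S.negB (S.projQ U.1.2) (S.projQ V.1.1))
    + 2 * x 2 * S.negB (S.projK U.1.1) (S.projK V.1.1) := rfl

theorem negB_symm (X Y : 𝔥) : S.negB X Y = S.negB Y X := by
  change -killingForm ℝ 𝔥 X Y = -killingForm ℝ 𝔥 Y X
  rw [LieModule.traceForm_comm]

theorem negB_pos {X : 𝔥} (hX : X ≠ 0) : 0 < S.negB X X :=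
  neg_pos.2 (S.compact X hX)

theorem negB_nonneg (X : 𝔥) : 0 ≤ S.negB X X := by
  rcases eq_or_ne X 0 with rfl | h
  · simp
  · exact (S.negB_pos h).le

theorem negB_lie (Z X Y : 𝔥) : S.negB ⁅Z, X⁆ Y = -S.negB X ⁅Z, Y⁆ := by
  change -killingForm ℝ 𝔥 ⁅Z, X⁆ Y = - -killingForm ℝ 𝔥 X ⁅Z, Y⁆
  rw [← lie_skew, map_neg, LinearMap.neg_apply, LieModule.traceForm_apply_lie_apply]

end SymmetricPair

/-- The parameters `(x₁, x₂, x₃, x₄)` of the metrics in `𝓜⁴`. -/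
def MemM4 (x : Fin 4 → ℝ) : Prop := 0 < x 0 ∧ 0 < x 1 ∧ 0 < x 2 ∧ x 3 ^ 2 < x 0 * x 1

namespace SymmetricPair

variable {𝔥 : Type*} [LieRing 𝔥] [LieAlgebra ℝ 𝔥] [FiniteDimensional ℝ 𝔥] (S : SymmetricPair 𝔥)

theorem formM4_pos {x : Fin 4 → ℝ} (hx : MemM4 x) (U : S.M.compl) (hU : U ≠ 0) :
    0 < S.formM4 x U U := by
  obtain ⟨h0, h1, h2, h3⟩ := hx
  rw [formM4_apply, S.negB_symm (S.projQ U.1.2) (S.projQ U.1.1)]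
  set X := S.projQ U.1.1 with hX
  set Y := S.projQ U.1.2 with hY
  set Z := S.projK U.1.1 with hZ
  have key : x 0 * (x 0 * S.negB X X + x 1 * S.negB Y Y + x 3 * (S.negB X Y + S.negB X Y)
      + 2 * x 2 * S.negB Z Z) = S.negB (x 0 • X + x 3 • Y) (x 0 • X + x 3 • Y)
      + (x 0 * x 1 - x 3 ^ 2) * S.negB Y Y + 2 * x 0 * x 2 * S.negB Z Z := by
    simp only [map_add, map_smul, LinearMap.add_apply, LinearMap.smul_apply, smul_eq_mul]
    rw [S.negB_symm Y X]
    ring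
  refine pos_of_mul_pos_right (a := x 0) ?_ h0.le
  rw [key]
  have e1 := S.negB_nonneg (x 0 • X + x 3 • Y)
  have e2 := mul_nonneg (sub_pos.2 h3).le (S.negB_nonneg Y)
  have e3 := mul_nonneg (by positivity : 0 ≤ 2 * x 0 * x 2) (S.negB_nonneg Z)
  by_cases hZ0 : Z = 0
  · by_cases hY0 : Y = 0
    · have hX0 : X ≠ 0 := by
        intro hX0
        apply hU
        have hc := S.mem_compl.1 U.2
        rw [← hZ, hZ0, neg_zero] at hc
        refine Subtype.ext (Prod.ext ?_ ?_)
        · rw [← S.projK_add_projQ U.1.1, ← hX, ← hZ, hX0, hZ0, add_zero]; rfl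
        · rw [← S.projK_add_projQ U.1.2, ← hY, hc, hY0, add_zero]; rfl
      have : 0 < S.negB (x 0 • X + x 3 • Y) (x 0 • X + x 3 • Y) := by
        apply S.negB_pos
        rw [hY0, smul_zero, add_zero]
        exact smul_ne_zero h0.ne' hX0
      linarith
    · have := mul_pos (sub_pos.2 h3) (S.negB_pos hY0)
      linarith
  · have := mul_pos (by positivity : 0 < 2 * x 0 * x 2) (S.negB_pos hZ0)
    linarith

/-- The `G`-invariant metric `g = (x₁, x₂, x₃, x₄)` on `M = H × H / ΔK`. -/
noncomputable def metric (x : Fin 4 → ℝ) (hx : MemM4 x) : S.M.InvariantMetric where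
  form := S.formM4 x
  symm U V := by
    simp only [formM4_apply]
    rw [S.negB_symm (S.projQ U.1.1) (S.projQ V.1.1), S.negB_symm (S.projQ U.1.2) (S.projQ V.1.2),
      S.negB_symm (S.projQ U.1.1) (S.projQ V.1.2), S.negB_symm (S.projQ U.1.2) (S.projQ V.1.1),
      S.negB_symm (S.projK U.1.1) (S.projK V.1.1)]
    ring
  pos := S.formM4_pos hx
  invariant := by
    intro Z U V
    obtain ⟨h1, h2⟩ := S.mem_Δ𝔨.1 Z.2
    have e1 : ∀ W : S.M.compl, (S.M.isotropyRep Z W).1.1 = ⁅Z.1.1, W.1.1⁆ := fun _ => rfl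
    have e2 : ∀ W : S.M.compl, (S.M.isotropyRep Z W).1.2 = ⁅Z.1.1, W.1.2⁆ := by
      intro W
      rw [← h2]
      rfl
    simp only [formM4_apply, e1, e2, S.projQ_lie h1, S.projK_lie h1, S.negB_lie]
    ring

/-! ### Scalar curvature and volume as functions of the parameters -/

open Classical in
/-- The scalar curvature of the metric `(x₁, x₂, x₃, x₄)` (zero outside `𝓜⁴`). -/
noncomputable def scal (x : Fin 4 → ℝ) : ℝ :=
  if hx : MemM4 x then (S.metric x hx).scalarCurvature else 0

theorem memM4_standard : MemM4 ![1, 1, 1, 0] := by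
  simp [MemM4]

/-- The standard metric, given by `-B_𝔤` on `𝔭`. -/
noncomputable def standardMetric : S.M.InvariantMetric := S.metric ![1, 1, 1, 0] memM4_standard

open Classical in
/-- The volume of `M` for the metric `(x₁, x₂, x₃, x₄)` (zero outside `𝓜⁴`), where `V₀` is the
volume of `M` for the standard metric. The Riemannian densities of two `G`-invariant metrics differ
by the constant factor `√det`. -/
noncomputable def volume (V₀ : ℝ) (x : Fin 4 → ℝ) : ℝ :=
  if hx : MemM4 x then V₀ * √(S.standardMetric.detRel (S.metric x hx)) else 0

/-- The manifold `𝓜⁴₁` of metrics of volume one in `𝓜⁴`. -/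
def unitM4 (V₀ : ℝ) : Set (Fin 4 → ℝ) := {x | MemM4 x ∧ S.volume V₀ x = 1}

/-! ### Second variation of the scalar curvature on unit volume metrics -/

/-- `γ` is (the germ at `0` of) a smooth curve in `𝓜⁴₁` through `x` with velocity `T` at `x`. -/
structure IsCurve (V₀ : ℝ) (x T : Fin 4 → ℝ) (γ : ℝ → Fin 4 → ℝ) : Prop where
  smooth : ContDiffAt ℝ ∞ γ 0
  mem : ∀ᶠ t in 𝓝 0, γ t ∈ S.unitM4 V₀
  base : γ 0 = x
  velocity : HasDerivAt γ T 0

/-- The tangent space `T_x 𝓜⁴₁`, spanned by the velocities at `x` of smooth curves in `𝓜⁴₁`. -/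
def tangentSpace (V₀ : ℝ) (x : Fin 4 → ℝ) : Submodule ℝ (Fin 4 → ℝ) :=
  Submodule.span ℝ {T | ∃ γ, S.IsCurve V₀ x T γ}

/-- `x` is a critical point of the scalar curvature on `𝓜⁴₁`. -/
def IsCriticalPoint (V₀ : ℝ) (x : Fin 4 → ℝ) : Prop :=
  x ∈ S.unitM4 V₀ ∧ ∀ T γ, S.IsCurve V₀ x T γ → HasDerivAt (fun t => S.scal (γ t)) 0 0

/-- `Q` is the second derivative `scal''` on `T_x 𝓜⁴₁` of the scalar curvature at the critical
point `x`: the symmetric bilinear form such that every tangent vector `T` is the velocity of some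
smooth curve `γ` in `𝓜⁴₁`, and `Q(T, T) = (scal ∘ γ)''(0)` for all of these curves. -/
structure IsHessian (V₀ : ℝ) (x : Fin 4 → ℝ)
    (Q : LinearMap.BilinForm ℝ (S.tangentSpace V₀ x)) : Prop where
  symm : ∀ T T', Q T T' = Q T' T
  exists_curve : ∀ T : S.tangentSpace V₀ x, ∃ γ, S.IsCurve V₀ x T γ
  second_deriv : ∀ (T : S.tangentSpace V₀ x) γ, S.IsCurve V₀ x T γ →
    ContDiffAt ℝ 2 (fun t => S.scal (γ t)) 0 ∧ iteratedDeriv 2 (fun t => S.scal (γ t)) 0 = Q T T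

end SymmetricPair

/-- The coindex of a bilinear form `Q` is `m`: the maximal dimension of a subspace on which `Q` is
positive definite is `m`. -/
def HasCoindex {V : Type*} [AddCommGroup V] [Module ℝ V] (Q : LinearMap.BilinForm ℝ V) (m : ℕ) :
    Prop :=
  IsGreatest {k : ℕ | ∃ W : Submodule ℝ V, Module.finrank ℝ W = k ∧
    ∀ w ∈ W, w ≠ 0 → 0 < Q w w} m

namespace SymmetricPair

variable {𝔥 : Type*} [LieRing 𝔥] [LieAlgebra ℝ 𝔥] [FiniteDimensional ℝ 𝔥] (S : SymmetricPair 𝔥)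

/-- The metric `x` is a unit volume Einstein metric, a critical point of the scalar curvature on
`𝓜⁴₁`, non-degenerate, `G`-unstable and of coindex `m`. -/
def IsNondegenerateUnstableEinstein (V₀ : ℝ) (x : Fin 4 → ℝ) (m : ℕ) : Prop :=
  x ∈ S.unitM4 V₀ ∧ (∃ hx : MemM4 x, (S.metric x hx).IsEinstein) ∧ S.IsCriticalPoint V₀ x ∧
    ∃ Q : LinearMap.BilinForm ℝ (S.tangentSpace V₀ x), S.IsHessian V₀ x Q ∧
      Q.Nondegenerate ∧ (∃ T, 0 < Q T T) ∧ HasCoindex Q m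

end SymmetricPair

/-! The metrics form a four-parameter family, so everything reduces to explicit functions of `x`, `n
= dim 𝔮` and `d = dim 𝔨`. The connection has components that are combinations of brackets
(`leviCivita_metric`). The traces defining the Ricci tensor then become Casimir sums. On `𝔮`, the
relations `[𝔮, 𝔮] ⊆ 𝔨` and `[𝔨, 𝔮] ⊆ 𝔮` make the sums over `𝔮` and over `𝔨` equal, each half of `-B`
(`sum_eQ_lie_lie`, `sum_eK_lie_lie`). On `𝔨` the only further invariant is `-B_𝔨`, whose trace is `d
- n / 2`. This gives `ricci_apply`, from which the Einstein equations are read off, and the rational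
function `scalM4`. The logarithm of the squared relative volume is `n log (x₁ x₂ - x₄²) + d log x₃`
(`detRel_metric`).

The second variation is a Lagrange multiplier argument. On unit volume metrics the scalar curvature
equals `lagM4`, that is `scalM4 - l * volM4`, up to a constant. At an Einstein metric with `ric = k
g` the choice `l = -k` makes `lagM4` critical in all four directions. The acceleration of a curve
then drops out, and the Hessian is the second derivative of `lagM4` on the three-dimensional kernel
of the differential of `volM4`. At each of the two metrics three tangent vectors are exhibited that
are pairwise orthogonal for this form and have nonzero values. By Sylvester's law of inertia the
number of positive values is the coindex: one for `g₅`, two for `g₃`.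

For `g₃` the hypothesis on `B_𝔨` supplies the Einstein equation on `𝔭₃`. Its trace `n = 2 (1 - a) d`
forces `a < 1`, hence `y₊ < 1 / 2`, which decides the signs. -/

/-! ### Orthonormal bases and traces -/

/-- A symmetric positive definite bilinear form on a finite-dimensional real space has an
orthonormal basis. -/
theorem LinearMap.BilinForm.exists_orthonormal_basis {V : Type*} [AddCommGroup V] [Module ℝ V]
    [FiniteDimensional ℝ V] (B : LinearMap.BilinForm ℝ V) (hs : ∀ x y, B x y = B y x)
    (hp : ∀ x, x ≠ 0 → 0 < B x x) :
    ∃ b : Module.Basis (Fin (Module.finrank ℝ V)) ℝ V,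
      ∀ i j, B (b i) (b j) = if i = j then 1 else 0 := by
  obtain ⟨v, hv⟩ := LinearMap.BilinForm.exists_orthogonal_basis (B := B) ⟨fun x y => hs x y⟩
  have hpos : ∀ i, 0 < B (v i) (v i) := fun i => hp _ (v.ne_zero i)
  have hu : ∀ i, IsUnit ((√(B (v i) (v i)))⁻¹) := fun i =>
    (inv_ne_zero (Real.sqrt_ne_zero'.2 (hpos i))).isUnit
  refine ⟨v.isUnitSMul hu, fun i j => ?_⟩
  simp only [Module.Basis.isUnitSMul_apply, map_smul, LinearMap.smul_apply, smul_eq_mul]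
  split_ifs with h
  · subst h
    have h1 := Real.sq_sqrt (hpos i).le
    have h2 := Real.sqrt_ne_zero'.2 (hpos i)
    field_simp
    rw [h1]
  · have : B (v i) (v j) = 0 := hv h
    rw [this]; simp

theorem LinearMap.BilinForm.repr_of_orthonormal {V ι : Type*} [AddCommGroup V] [Module ℝ V]
    [Fintype ι] [DecidableEq ι] (B : LinearMap.BilinForm ℝ V) (b : Module.Basis ι ℝ V)
    (hb : ∀ i j, B (b i) (b j) = if i = j then 1 else 0) (x : V) (i : ι) :
    b.repr x i = B x (b i) := by
  have h := congrArg (fun y => B y (b i)) (b.sum_repr x)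
  simp only [map_sum, LinearMap.sum_apply, map_smul, LinearMap.smul_apply, hb, smul_eq_mul,
    mul_ite, mul_one, mul_zero, Finset.sum_ite_eq', Finset.mem_univ, if_true] at h
  exact h

theorem LinearMap.trace_eq_sum_repr {V ι : Type*} [AddCommGroup V] [Module ℝ V]
    [Fintype ι] (b : Module.Basis ι ℝ V) (T : Module.End ℝ V) :
    LinearMap.trace ℝ V T = ∑ i, b.repr (T (b i)) i := by
  classical
  rw [LinearMap.trace_eq_matrix_trace ℝ b]
  simp [Matrix.trace, LinearMap.toMatrix_apply]

/-! ### The decomposition of `𝔭` into two copies of `𝔮` and one of `𝔨`, with adapted orthonormal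
bases. -/

namespace SymmetricPair

variable {𝔥 : Type*} [LieRing 𝔥] [LieAlgebra ℝ 𝔥] [FiniteDimensional ℝ 𝔥] (S : SymmetricPair 𝔥)

theorem projQ_of_mem_𝔨 {X : 𝔥} (hX : X ∈ S.𝔨) : S.projQ X = 0 := by
  rw [mem_𝔨] at hX
  rw [projQ_apply, hX, sub_self, smul_zero]

theorem lie_mem_𝔮_of_𝔨_𝔮 {X Y : 𝔥} (hX : X ∈ S.𝔨) (hY : Y ∈ S.𝔮) : ⁅X, Y⁆ ∈ S.𝔮 := by
  rw [mem_𝔨] at hX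
  rw [mem_𝔮] at hY ⊢
  rw [LieHom.map_lie, hX, hY, lie_neg]

theorem lie_mem_𝔮_of_𝔮_𝔨 {X Y : 𝔥} (hX : X ∈ S.𝔮) (hY : Y ∈ S.𝔨) : ⁅X, Y⁆ ∈ S.𝔮 := by
  rw [← lie_skew]
  exact S.𝔮.neg_mem (S.lie_mem_𝔮_of_𝔨_𝔮 hY hX)

theorem lie_mem_𝔨_of_𝔮_𝔮 {X Y : 𝔥} (hX : X ∈ S.𝔮) (hY : Y ∈ S.𝔮) : ⁅X, Y⁆ ∈ S.𝔨 := by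
  rw [mem_𝔮] at hX hY
  rw [mem_𝔨, LieHom.map_lie, hX, hY, lie_neg, neg_lie, neg_neg]

/-- The decomposition `𝔥 = 𝔮 ⊕ 𝔨`. -/
noncomputable def decomp : 𝔥 ≃ₗ[ℝ] S.𝔮 × S.𝔨 where
  toFun X := (⟨S.projQ X, S.projQ_mem X⟩, ⟨S.projK X, S.projK_mem X⟩)
  map_add' X Y := by ext <;> simp
  map_smul' c X := by ext <;> simp
  invFun p := (p.1 : 𝔥) + p.2
  left_inv X := by
    simp only
    rw [add_comm, S.projK_add_projQ]
  right_inv p := by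
    ext
    · simp [S.projQ_of_mem p.1.2, S.projQ_of_mem_𝔨 p.2.2]
    · simp [S.projK_of_mem_𝔮 p.1.2, S.projK_of_mem p.2.2]

/-- The first component of `𝔭` in `𝔮`. -/
noncomputable def fstQ : S.M.compl →ₗ[ℝ] 𝔥 := S.projQ ∘ₗ LinearMap.fst ℝ 𝔥 𝔥 ∘ₗ S.M.compl.subtype

/-- The second component of `𝔭` in `𝔮`. -/
noncomputable def sndQ : S.M.compl →ₗ[ℝ] 𝔥 := S.projQ ∘ₗ LinearMap.snd ℝ 𝔥 𝔥 ∘ₗ S.M.compl.subtype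

/-- The component of `𝔭` in `𝔨 ≅ 𝔭₃`. -/
noncomputable def cmpK : S.M.compl →ₗ[ℝ] 𝔥 := S.projK ∘ₗ LinearMap.fst ℝ 𝔥 𝔥 ∘ₗ S.M.compl.subtype

theorem fstQ_apply (U : S.M.compl) : S.fstQ U = S.projQ U.1.1 := rfl

theorem sndQ_apply (U : S.M.compl) : S.sndQ U = S.projQ U.1.2 := rfl

theorem cmpK_apply (U : S.M.compl) : S.cmpK U = S.projK U.1.1 := rfl

theorem fstQ_mem (U : S.M.compl) : S.fstQ U ∈ S.𝔮 := S.projQ_mem _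

theorem sndQ_mem (U : S.M.compl) : S.sndQ U ∈ S.𝔮 := S.projQ_mem _

theorem cmpK_mem (U : S.M.compl) : S.cmpK U ∈ S.𝔨 := S.projK_mem _

theorem coe_fst (U : S.M.compl) : U.1.1 = S.fstQ U + S.cmpK U := by
  rw [fstQ_apply, cmpK_apply, add_comm, S.projK_add_projQ]

theorem coe_snd (U : S.M.compl) : U.1.2 = S.sndQ U - S.cmpK U := by
  rw [sndQ_apply, cmpK_apply, sub_eq_add_neg, ← S.mem_compl.1 U.2, add_comm, S.projK_add_projQ]

theorem mk_mem_compl {X Y Z : 𝔥} (hX : X ∈ S.𝔮) (hY : Y ∈ S.𝔮) (hZ : Z ∈ S.𝔨) :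
    ((X + Z, Y - Z) : 𝔥 × 𝔥) ∈ S.M.compl := by
  rw [mem_compl]
  simp [S.projK_of_mem_𝔮 hX, S.projK_of_mem_𝔮 hY, S.projK_of_mem hZ]

/-- The element `(X + Z, Y - Z)` of `𝔭`. -/
def complMk (X Y Z : 𝔥) (hX : X ∈ S.𝔮) (hY : Y ∈ S.𝔮) (hZ : Z ∈ S.𝔨) : S.M.compl :=
  ⟨(X + Z, Y - Z), S.mk_mem_compl hX hY hZ⟩

section

variable {X Y Z : 𝔥} (hX : X ∈ S.𝔮) (hY : Y ∈ S.𝔮) (hZ : Z ∈ S.𝔨)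

@[simp] theorem fstQ_complMk : S.fstQ (S.complMk X Y Z hX hY hZ) = X := by
  simp [fstQ_apply, complMk, S.projQ_of_mem hX, S.projQ_of_mem_𝔨 hZ]

@[simp] theorem sndQ_complMk : S.sndQ (S.complMk X Y Z hX hY hZ) = Y := by
  simp [sndQ_apply, complMk, S.projQ_of_mem hY, S.projQ_of_mem_𝔨 hZ]

@[simp] theorem cmpK_complMk : S.cmpK (S.complMk X Y Z hX hY hZ) = Z := by
  simp [cmpK_apply, complMk, S.projK_of_mem hZ, S.projK_of_mem_𝔮 hX]

end

theorem compl_ext {U V : S.M.compl} (h1 : S.fstQ U = S.fstQ V) (h2 : S.sndQ U = S.sndQ V)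
    (h3 : S.cmpK U = S.cmpK V) : U = V := by
  apply Subtype.ext
  apply Prod.ext
  · rw [coe_fst, coe_fst, h1, h3]
  · rw [coe_snd, coe_snd, h2, h3]

/-- The decomposition `𝔭 ≅ 𝔮 ⊕ 𝔮 ⊕ 𝔨`. -/
noncomputable def complEquiv : S.M.compl ≃ₗ[ℝ] (S.𝔮 × S.𝔮) × S.𝔨 where
  toFun U := ((⟨S.fstQ U, S.fstQ_mem U⟩, ⟨S.sndQ U, S.sndQ_mem U⟩), ⟨S.cmpK U, S.cmpK_mem U⟩)
  map_add' X Y := by ext <;> simp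
  map_smul' c X := by ext <;> simp
  invFun p := S.complMk p.1.1 p.1.2 p.2 p.1.1.2 p.1.2.2 p.2.2
  left_inv U := S.compl_ext (by simp) (by simp) (by simp)
  right_inv p := by ext <;> simp

theorem exists_orthonormal_𝔮 : ∃ e : Module.Basis (Fin (Module.finrank ℝ S.𝔮)) ℝ S.𝔮,
    ∀ i j, S.negB (e i) (e j) = if i = j then 1 else 0 :=
  LinearMap.BilinForm.exists_orthonormal_basis (S.negB.compl₁₂ S.𝔮.subtype S.𝔮.subtype)
    (fun x y => S.negB_symm x y) (fun x hx => S.negB_pos (by simpa using hx))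

theorem exists_orthonormal_𝔨 : ∃ f : Module.Basis (Fin (Module.finrank ℝ S.𝔨)) ℝ S.𝔨,
    ∀ i j, S.negB (f i) (f j) = if i = j then 1 else 0 :=
  LinearMap.BilinForm.exists_orthonormal_basis
    (S.negB.compl₁₂ S.𝔨.toSubmodule.subtype S.𝔨.toSubmodule.subtype)
    (fun x y => S.negB_symm x y) (fun x hx => S.negB_pos (by simpa using hx))

/-- An orthonormal basis of `𝔮` for `-B`. -/
noncomputable def basisQ : Module.Basis (Fin (Module.finrank ℝ S.𝔮)) ℝ S.𝔮 :=
  S.exists_orthonormal_𝔮.choose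

/-- An orthonormal basis of `𝔨` for `-B`. -/
noncomputable def basisK : Module.Basis (Fin (Module.finrank ℝ S.𝔨)) ℝ S.𝔨 :=
  S.exists_orthonormal_𝔨.choose

/-- The vectors of `basisQ`, in `𝔥`. -/
noncomputable def eQ (i : Fin (Module.finrank ℝ S.𝔮)) : 𝔥 := S.basisQ i

/-- The vectors of `basisK`, in `𝔥`. -/
noncomputable def eK (i : Fin (Module.finrank ℝ S.𝔨)) : 𝔥 := S.basisK i

theorem eQ_mem (i) : S.eQ i ∈ S.𝔮 := (S.basisQ i).2

theorem eK_mem (i) : S.eK i ∈ S.𝔨 := (S.basisK i).2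

theorem negB_eQ_eQ (i j) : S.negB (S.eQ i) (S.eQ j) = if i = j then 1 else 0 :=
  S.exists_orthonormal_𝔮.choose_spec i j

theorem negB_eK_eK (i j) : S.negB (S.eK i) (S.eK j) = if i = j then 1 else 0 :=
  S.exists_orthonormal_𝔨.choose_spec i j

theorem basisQ_repr (X : S.𝔮) (i) : S.basisQ.repr X i = S.negB X (S.eQ i) :=
  LinearMap.BilinForm.repr_of_orthonormal (S.negB.compl₁₂ S.𝔮.subtype S.𝔮.subtype) S.basisQ
    S.negB_eQ_eQ X i

theorem basisK_repr (X : S.𝔨) (i) : S.basisK.repr X i = S.negB X (S.eK i) :=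
  LinearMap.BilinForm.repr_of_orthonormal
    (S.negB.compl₁₂ S.𝔨.toSubmodule.subtype S.𝔨.toSubmodule.subtype) S.basisK
    S.negB_eK_eK X i

/-- Parseval's identity in `𝔮`. -/
theorem sum_negB_eQ {X : 𝔥} (hX : X ∈ S.𝔮) (Y : 𝔥) :
    ∑ i, S.negB X (S.eQ i) * S.negB (S.eQ i) Y = S.negB X Y := by
  have h := congrArg Subtype.val (S.basisQ.sum_repr ⟨X, hX⟩)
  conv_rhs => rw [show X = ((⟨X, hX⟩ : S.𝔮) : 𝔥) from rfl, ← h]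
  simp [basisQ_repr, eQ]

/-- Parseval's identity in `𝔨`. -/
theorem sum_negB_eK {X : 𝔥} (hX : X ∈ S.𝔨) (Y : 𝔥) :
    ∑ i, S.negB X (S.eK i) * S.negB (S.eK i) Y = S.negB X Y := by
  have h := congrArg Subtype.val (S.basisK.sum_repr ⟨X, hX⟩)
  conv_rhs => rw [show X = ((⟨X, hX⟩ : S.𝔨) : 𝔥) from rfl, ← h]
  simp [basisK_repr, eK]

/-- The Killing form is invariant under automorphisms. This forces the two eigenspaces of `θ` to be
orthogonal, so the projections may be dropped when pairing with basis vectors. -/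
theorem negB_θ (X Y : 𝔥) : S.negB (S.θ X) (S.θ Y) = S.negB X Y := by
  let e : 𝔥 ≃ₗ⁅ℝ⁆ 𝔥 := { S.θ with
    invFun := S.θ
    left_inv := S.involutive
    right_inv := S.involutive }
  exact congrArg Neg.neg (LieAlgebra.killingForm_of_equiv_apply e X Y)

theorem negB_𝔨_𝔮 {X Y : 𝔥} (hX : X ∈ S.𝔨) (hY : Y ∈ S.𝔮) : S.negB X Y = 0 := by
  have h := S.negB_θ X Y
  rw [S.mem_𝔨.1 hX, S.mem_𝔮.1 hY, map_neg] at h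
  linarith

theorem negB_𝔮_𝔨 {X Y : 𝔥} (hX : X ∈ S.𝔮) (hY : Y ∈ S.𝔨) : S.negB X Y = 0 := by
  rw [negB_symm, S.negB_𝔨_𝔮 hY hX]

theorem negB_projQ (X : 𝔥) {Y : 𝔥} (hY : Y ∈ S.𝔮) : S.negB (S.projQ X) Y = S.negB X Y := by
  conv_rhs => rw [← S.projK_add_projQ X]
  rw [map_add, LinearMap.add_apply, S.negB_𝔨_𝔮 (S.projK_mem X) hY, zero_add]

theorem negB_projK (X : 𝔥) {Y : 𝔥} (hY : Y ∈ S.𝔨) : S.negB (S.projK X) Y = S.negB X Y := by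
  conv_rhs => rw [← S.projK_add_projQ X]
  rw [map_add, LinearMap.add_apply, S.negB_𝔮_𝔨 (S.projQ_mem X) hY, add_zero]

/-- The trace of an endomorphism of `𝔥` in an orthonormal basis adapted to `𝔥 = 𝔮 ⊕ 𝔨`. -/
theorem trace_eq_sum (T : Module.End ℝ 𝔥) : LinearMap.trace ℝ 𝔥 T =
    ∑ i, S.negB (T (S.eQ i)) (S.eQ i) + ∑ i, S.negB (T (S.eK i)) (S.eK i) := by
  rw [LinearMap.trace_eq_sum_repr ((S.basisQ.prod S.basisK).map S.decomp.symm),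
    Fintype.sum_sum_type]
  congr 1 <;> refine Finset.sum_congr rfl fun i _ => ?_
  · simp only [Module.Basis.map_repr, LinearEquiv.trans_apply, LinearEquiv.symm_symm,
      Module.Basis.map_apply, Module.Basis.prod_repr_inl, basisQ_repr]
    have h : S.decomp.symm ((S.basisQ.prod S.basisK) (Sum.inl i)) = S.eQ i := by
      simp [Module.Basis.prod_apply, decomp, eQ]
    rw [h]
    exact S.negB_projQ _ (S.eQ_mem i)
  · simp only [Module.Basis.map_repr, LinearEquiv.trans_apply, LinearEquiv.symm_symm,
      Module.Basis.map_apply, Module.Basis.prod_repr_inr, basisK_repr]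
    have h : S.decomp.symm ((S.basisQ.prod S.basisK) (Sum.inr i)) = S.eK i := by
      simp [Module.Basis.prod_apply, decomp, eK]
    rw [h]
    exact S.negB_projK _ (S.eK_mem i)

/-- The orthonormal basis of `𝔭` for the form with `𝔭₁ ≅ 𝔮`, `𝔭₂ ≅ 𝔮`, `𝔭₃ ≅ 𝔨`. -/
noncomputable def basisCompl : Module.Basis ((Fin (Module.finrank ℝ S.𝔮) ⊕
    Fin (Module.finrank ℝ S.𝔮)) ⊕ Fin (Module.finrank ℝ S.𝔨)) ℝ S.M.compl :=
  ((S.basisQ.prod S.basisQ).prod S.basisK).map S.complEquiv.symm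

/-- The basis vector `(e_i, 0)` of `𝔭₁`. -/
noncomputable def e₁ (i : Fin (Module.finrank ℝ S.𝔮)) : S.M.compl :=
  S.complMk (S.eQ i) 0 0 (S.eQ_mem i) (Submodule.zero_mem _) (LieSubalgebra.zero_mem _)

/-- The basis vector `(0, e_i)` of `𝔭₂`. -/
noncomputable def e₂ (i : Fin (Module.finrank ℝ S.𝔮)) : S.M.compl :=
  S.complMk 0 (S.eQ i) 0 (Submodule.zero_mem _) (S.eQ_mem i) (LieSubalgebra.zero_mem _)

/-- The basis vector `(f_i, -f_i)` of `𝔭₃`. -/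
noncomputable def e₃ (i : Fin (Module.finrank ℝ S.𝔨)) : S.M.compl :=
  S.complMk 0 0 (S.eK i) (Submodule.zero_mem _) (Submodule.zero_mem _) (S.eK_mem i)

@[simp] theorem fstQ_e₁ (i) : S.fstQ (S.e₁ i) = S.eQ i := S.fstQ_complMk _ _ _
@[simp] theorem sndQ_e₁ (i) : S.sndQ (S.e₁ i) = 0 := S.sndQ_complMk _ _ _
@[simp] theorem cmpK_e₁ (i) : S.cmpK (S.e₁ i) = 0 := S.cmpK_complMk _ _ _
@[simp] theorem fstQ_e₂ (i) : S.fstQ (S.e₂ i) = 0 := S.fstQ_complMk _ _ _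
@[simp] theorem sndQ_e₂ (i) : S.sndQ (S.e₂ i) = S.eQ i := S.sndQ_complMk _ _ _
@[simp] theorem cmpK_e₂ (i) : S.cmpK (S.e₂ i) = 0 := S.cmpK_complMk _ _ _
@[simp] theorem fstQ_e₃ (i) : S.fstQ (S.e₃ i) = 0 := S.fstQ_complMk _ _ _
@[simp] theorem sndQ_e₃ (i) : S.sndQ (S.e₃ i) = 0 := S.sndQ_complMk _ _ _
@[simp] theorem cmpK_e₃ (i) : S.cmpK (S.e₃ i) = S.eK i := S.cmpK_complMk _ _ _

theorem basisCompl_inl_inl (i) : S.basisCompl (Sum.inl (Sum.inl i)) = S.e₁ i := by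
  apply S.compl_ext <;> simp [basisCompl, Module.Basis.prod_apply, complEquiv, eQ]

theorem basisCompl_inl_inr (i) : S.basisCompl (Sum.inl (Sum.inr i)) = S.e₂ i := by
  apply S.compl_ext <;> simp [basisCompl, Module.Basis.prod_apply, complEquiv, eQ]

theorem basisCompl_inr (i) : S.basisCompl (Sum.inr i) = S.e₃ i := by
  apply S.compl_ext <;> simp [basisCompl, Module.Basis.prod_apply, complEquiv, eK]

theorem basisCompl_repr_inl_inl (U : S.M.compl) (i) :
    S.basisCompl.repr U (Sum.inl (Sum.inl i)) = S.negB (S.fstQ U) (S.eQ i) := by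
  simp only [basisCompl, Module.Basis.map_repr, LinearEquiv.trans_apply, LinearEquiv.symm_symm,
    Module.Basis.prod_repr_inl, basisQ_repr]
  rfl

theorem basisCompl_repr_inl_inr (U : S.M.compl) (i) :
    S.basisCompl.repr U (Sum.inl (Sum.inr i)) = S.negB (S.sndQ U) (S.eQ i) := by
  simp only [basisCompl, Module.Basis.map_repr, LinearEquiv.trans_apply, LinearEquiv.symm_symm,
    Module.Basis.prod_repr_inl, Module.Basis.prod_repr_inr, basisQ_repr]
  rfl

theorem basisCompl_repr_inr (U : S.M.compl) (i) :
    S.basisCompl.repr U (Sum.inr i) = S.negB (S.cmpK U) (S.eK i) := by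
  simp only [basisCompl, Module.Basis.map_repr, LinearEquiv.trans_apply, LinearEquiv.symm_symm,
    Module.Basis.prod_repr_inr, basisK_repr]
  rfl

/-- The trace of an endomorphism of `𝔭`. -/
theorem trace_compl (T : Module.End ℝ S.M.compl) : LinearMap.trace ℝ S.M.compl T =
    ∑ i, S.negB (S.fstQ (T (S.e₁ i))) (S.eQ i) + ∑ i, S.negB (S.sndQ (T (S.e₂ i))) (S.eQ i)
      + ∑ i, S.negB (S.cmpK (T (S.e₃ i))) (S.eK i) := by
  rw [LinearMap.trace_eq_sum_repr S.basisCompl, Fintype.sum_sum_type, Fintype.sum_sum_type]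
  simp only [basisCompl_inl_inl, basisCompl_inl_inr, basisCompl_inr, basisCompl_repr_inl_inl,
    basisCompl_repr_inl_inr, basisCompl_repr_inr]

/-! ### Casimir sums -/

theorem negB_lie_lie_swap (X Y E : 𝔥) : S.negB ⁅X, E⁆ ⁅Y, E⁆ = S.negB ⁅E, X⁆ ⁅E, Y⁆ := by
  rw [← lie_skew, ← lie_skew Y, map_neg, map_neg, LinearMap.neg_apply, neg_neg]

/-- The form `-B_𝔥` as a sum over an orthonormal basis. -/
theorem sum_negB_lie_add (X Y : 𝔥) : ∑ i, S.negB ⁅S.eQ i, X⁆ ⁅S.eQ i, Y⁆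
    + ∑ i, S.negB ⁅S.eK i, X⁆ ⁅S.eK i, Y⁆ = S.negB X Y := by
  have h : S.negB X Y = -LinearMap.trace ℝ 𝔥 (LieAlgebra.ad ℝ 𝔥 X ∘ₗ LieAlgebra.ad ℝ 𝔥 Y) :=
    congrArg Neg.neg (killingForm_apply_apply ℝ 𝔥 X Y)
  have h2 : ∀ E : 𝔥, S.negB ⁅X, ⁅Y, E⁆⁆ E = -S.negB ⁅E, X⁆ ⁅E, Y⁆ := by
    intro E
    rw [negB_lie, negB_symm, negB_lie_lie_swap]
  rw [h, S.trace_eq_sum]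
  simp only [LinearMap.comp_apply, LieAlgebra.ad_apply, h2, Finset.sum_neg_distrib]
  ring

/-- Since `[𝔮, X] ⊆ 𝔨` and `[𝔨, X] ⊆ 𝔮`, Parseval turns both sides into double sums over `𝔮` and
`𝔨`. Skewness of `ad` identifies these term by term, up to two signs that cancel. Only `X` has to
lie in `𝔮`. -/
theorem sum_eQ_eq_sum_eK {X : 𝔥} (hX : X ∈ S.𝔮) (Y : 𝔥) :
    ∑ i, S.negB ⁅S.eQ i, X⁆ ⁅S.eQ i, Y⁆ = ∑ i, S.negB ⁅S.eK i, X⁆ ⁅S.eK i, Y⁆ := by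
  have h1 : ∀ i, S.negB ⁅S.eQ i, X⁆ ⁅S.eQ i, Y⁆ = ∑ j, S.negB ⁅S.eQ i, X⁆ (S.eK j)
      * S.negB (S.eK j) ⁅S.eQ i, Y⁆ := fun i =>
    (S.sum_negB_eK (S.lie_mem_𝔨_of_𝔮_𝔮 (S.eQ_mem i) hX) _).symm
  have h2 : ∀ j, S.negB ⁅S.eK j, X⁆ ⁅S.eK j, Y⁆ = ∑ i, S.negB ⁅S.eK j, X⁆ (S.eQ i)
      * S.negB (S.eQ i) ⁅S.eK j, Y⁆ := fun j =>
    (S.sum_negB_eQ (S.lie_mem_𝔮_of_𝔨_𝔮 (S.eK_mem j) hX) _).symm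
  simp only [h1, h2]
  rw [Finset.sum_comm]
  refine Finset.sum_congr rfl fun j _ => Finset.sum_congr rfl fun i _ => ?_
  have h3 : ∀ X, S.negB ⁅S.eQ i, X⁆ (S.eK j) = -S.negB ⁅S.eK j, X⁆ (S.eQ i) := by
    intro X
    rw [negB_lie, negB_lie, ← lie_skew, map_neg]
  rw [h3, S.negB_symm (S.eK j), h3, S.negB_symm (S.eQ i), neg_mul_neg]

/-- Two equal sums add up to `-B`, so each is half of it. -/
theorem sum_eQ_lie_lie {X : 𝔥} (hX : X ∈ S.𝔮) (Y : 𝔥) :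
    ∑ i, S.negB ⁅S.eQ i, X⁆ ⁅S.eQ i, Y⁆ = 1 / 2 * S.negB X Y := by
  linarith [S.sum_negB_lie_add X Y, S.sum_eQ_eq_sum_eK hX Y]

theorem sum_eK_lie_lie {X : 𝔥} (hX : X ∈ S.𝔮) (Y : 𝔥) :
    ∑ i, S.negB ⁅S.eK i, X⁆ ⁅S.eK i, Y⁆ = 1 / 2 * S.negB X Y := by
  linarith [S.sum_negB_lie_add X Y, S.sum_eQ_eq_sum_eK hX Y]

/-- The form `-B_𝔨` on `𝔨`, as a sum over an orthonormal basis. -/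
noncomputable def casK (Z W : 𝔥) : ℝ := ∑ i, S.negB ⁅S.eK i, Z⁆ ⁅S.eK i, W⁆

theorem sum_eK_lie_lie_eq_casK (Z W : 𝔥) :
    ∑ i, S.negB ⁅S.eK i, Z⁆ ⁅S.eK i, W⁆ = S.casK Z W := rfl

theorem sum_eQ_lie_lie_of_𝔨 (Z W : 𝔥) :
    ∑ i, S.negB ⁅S.eQ i, Z⁆ ⁅S.eQ i, W⁆ = S.negB Z W - S.casK Z W := by
  linarith [S.sum_negB_lie_add Z W, S.sum_eK_lie_lie_eq_casK Z W]

/-- Translates a hypothesis on the intrinsic Killing form of `𝔨` into one on the sum `casK` that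
appears in the Ricci tensor. -/
theorem killingForm_𝔨 (Z W : S.𝔨) : killingForm ℝ S.𝔨 Z W = -S.casK Z W := by
  rw [LieModule.traceForm_apply_apply, LinearMap.trace_eq_sum_repr S.basisK, casK,
    ← Finset.sum_neg_distrib]
  refine Finset.sum_congr rfl fun i _ => ?_
  rw [basisK_repr]
  change S.negB ⁅(Z : 𝔥), ⁅(W : 𝔥), S.eK i⁆⁆ (S.eK i) = _
  rw [negB_lie, negB_symm, negB_lie_lie_swap]

/-- The trace of the Casimir operator of `𝔨` on `𝔨`: `∑ -B_𝔨(f_i, f_i) = dim 𝔨 - dim 𝔮 / 2`. -/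
theorem sum_casK : ∑ i, S.casK (S.eK i) (S.eK i) =
    Module.finrank ℝ S.𝔨 - (Module.finrank ℝ S.𝔮 : ℝ) / 2 := by
  have h1 : ∀ j, S.casK (S.eK j) (S.eK j) =
      1 - ∑ i, S.negB ⁅S.eQ i, S.eK j⁆ ⁅S.eQ i, S.eK j⁆ := by
    intro j
    rw [sum_eQ_lie_lie_of_𝔨, S.negB_eK_eK, if_pos rfl]
    ring
  -- The double sum of `|[e_i, f_j]|²` is evaluated over `j` first: each unit vector `e_i` of `𝔮`
  -- contributes the Casimir eigenvalue `1 / 2`, for a total of `dim 𝔮 / 2`.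
  have h2 : ∀ i, ∑ j, S.negB ⁅S.eQ i, S.eK j⁆ ⁅S.eQ i, S.eK j⁆ = 1 / 2 := by
    intro i
    have h := S.sum_eK_lie_lie (S.eQ_mem i) (S.eQ i)
    rw [S.negB_eQ_eQ, if_pos rfl, mul_one] at h
    rw [← h]
    refine Finset.sum_congr rfl fun j _ => ?_
    rw [negB_lie_lie_swap]
  simp only [h1, Finset.sum_sub_distrib]
  rw [Finset.sum_comm]
  simp only [h2]
  simp
  ring

/-! ### The brackets of `𝔭` in components -/

/-- In `𝔨 ⊕ 𝔨` the diagonal part of a pair is the mean and the antidiagonal part is half the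
difference. This is the origin of every factor `1 / 2` in the bracket formulas. -/
theorem toCompl_eq (G : 𝔥 × 𝔥) : S.M.toCompl G =
    S.complMk (S.projQ G.1) (S.projQ G.2) ((1 / 2 : ℝ) • (S.projK G.1 - S.projK G.2))
      (S.projQ_mem _) (S.projQ_mem _)
      (S.𝔨.smul_mem _ (S.𝔨.sub_mem (S.projK_mem _) (S.projK_mem _))) := by
  have hm : (1 / 2 : ℝ) • (S.projK G.1 + S.projK G.2) ∈ S.𝔨 :=
    S.𝔨.smul_mem _ (S.𝔨.add_mem (S.projK_mem _) (S.projK_mem _))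
  have h0 : S.M.toCompl ((1 / 2 : ℝ) • (S.projK G.1 + S.projK G.2),
      (1 / 2 : ℝ) • (S.projK G.1 + S.projK G.2)) = 0 :=
    Submodule.projectionOnto_apply_of_mem_right S.M.isCompl.symm ⟨hm, rfl⟩
  set C := S.complMk (S.projQ G.1) (S.projQ G.2) ((1 / 2 : ℝ) • (S.projK G.1 - S.projK G.2))
      (S.projQ_mem _) (S.projQ_mem _)
      (S.𝔨.smul_mem _ (S.𝔨.sub_mem (S.projK_mem _) (S.projK_mem _))) with hC
  have h1 : S.M.toCompl (C : 𝔥 × 𝔥) = C :=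
    Submodule.projectionOnto_apply_left S.M.isCompl.symm C
  have h2 : G = ((1 / 2 : ℝ) • (S.projK G.1 + S.projK G.2),
      (1 / 2 : ℝ) • (S.projK G.1 + S.projK G.2)) + (C : 𝔥 × 𝔥) := by
    ext
    · change _ = (1 / 2 : ℝ) • (S.projK G.1 + S.projK G.2)
        + (S.projQ G.1 + (1 / 2 : ℝ) • (S.projK G.1 - S.projK G.2))
      conv_lhs => rw [← S.projK_add_projQ G.1]
      module
    · change _ = (1 / 2 : ℝ) • (S.projK G.1 + S.projK G.2)
        + (S.projQ G.2 - (1 / 2 : ℝ) • (S.projK G.1 - S.projK G.2))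
      conv_lhs => rw [← S.projK_add_projQ G.2]
      module
  rw [h2, map_add, h0, h1, zero_add]

theorem toIsotropy_eq (G : 𝔥 × 𝔥) : (S.M.toIsotropy G : 𝔥 × 𝔥) =
    ((1 / 2 : ℝ) • (S.projK G.1 + S.projK G.2), (1 / 2 : ℝ) • (S.projK G.1 + S.projK G.2)) := by
  have h : (S.M.toIsotropy G : 𝔥 × 𝔥) + S.M.toCompl G = G :=
    Submodule.projection_add_projection_eq_self S.M.isCompl G
  rw [← eq_sub_iff_add_eq] at h
  rw [h, toCompl_eq]
  ext
  · change G.1 - (S.projQ G.1 + (1 / 2 : ℝ) • (S.projK G.1 - S.projK G.2)) = _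
    nth_rw 1 [← S.projK_add_projQ G.1]
    module
  · change G.2 - (S.projQ G.2 - (1 / 2 : ℝ) • (S.projK G.1 - S.projK G.2)) = _
    nth_rw 1 [← S.projK_add_projQ G.2]
    module

section brackets

variable (U V W : S.M.compl)

theorem projQ_lie_fst : S.projQ ⁅U.1.1, V.1.1⁆ =
    ⁅S.fstQ U, S.cmpK V⁆ + ⁅S.cmpK U, S.fstQ V⁆ := by
  rw [coe_fst, coe_fst, lie_add, add_lie, add_lie]
  simp only [map_add]
  rw [S.projQ_of_mem_𝔨 (S.lie_mem_𝔨_of_𝔮_𝔮 (S.fstQ_mem U) (S.fstQ_mem V)),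
    S.projQ_of_mem (S.lie_mem_𝔮_of_𝔨_𝔮 (S.cmpK_mem U) (S.fstQ_mem V)),
    S.projQ_of_mem (S.lie_mem_𝔮_of_𝔮_𝔨 (S.fstQ_mem U) (S.cmpK_mem V)),
    S.projQ_of_mem_𝔨 (S.𝔨.lie_mem (S.cmpK_mem U) (S.cmpK_mem V))]
  abel

theorem projK_lie_fst : S.projK ⁅U.1.1, V.1.1⁆ =
    ⁅S.fstQ U, S.fstQ V⁆ + ⁅S.cmpK U, S.cmpK V⁆ := by
  rw [coe_fst, coe_fst, lie_add, add_lie, add_lie]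
  simp only [map_add]
  rw [S.projK_of_mem (S.lie_mem_𝔨_of_𝔮_𝔮 (S.fstQ_mem U) (S.fstQ_mem V)),
    S.projK_of_mem_𝔮 (S.lie_mem_𝔮_of_𝔨_𝔮 (S.cmpK_mem U) (S.fstQ_mem V)),
    S.projK_of_mem_𝔮 (S.lie_mem_𝔮_of_𝔮_𝔨 (S.fstQ_mem U) (S.cmpK_mem V)),
    S.projK_of_mem (S.𝔨.lie_mem (S.cmpK_mem U) (S.cmpK_mem V))]
  abel

theorem projQ_lie_snd : S.projQ ⁅U.1.2, V.1.2⁆ =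
    -⁅S.sndQ U, S.cmpK V⁆ - ⁅S.cmpK U, S.sndQ V⁆ := by
  rw [coe_snd, coe_snd, lie_sub, sub_lie, sub_lie]
  simp only [map_sub]
  rw [S.projQ_of_mem_𝔨 (S.lie_mem_𝔨_of_𝔮_𝔮 (S.sndQ_mem U) (S.sndQ_mem V)),
    S.projQ_of_mem (S.lie_mem_𝔮_of_𝔨_𝔮 (S.cmpK_mem U) (S.sndQ_mem V)),
    S.projQ_of_mem (S.lie_mem_𝔮_of_𝔮_𝔨 (S.sndQ_mem U) (S.cmpK_mem V)),
    S.projQ_of_mem_𝔨 (S.𝔨.lie_mem (S.cmpK_mem U) (S.cmpK_mem V))]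
  abel

theorem projK_lie_snd : S.projK ⁅U.1.2, V.1.2⁆ =
    ⁅S.sndQ U, S.sndQ V⁆ + ⁅S.cmpK U, S.cmpK V⁆ := by
  rw [coe_snd, coe_snd, lie_sub, sub_lie, sub_lie]
  simp only [map_sub]
  rw [S.projK_of_mem (S.lie_mem_𝔨_of_𝔮_𝔮 (S.sndQ_mem U) (S.sndQ_mem V)),
    S.projK_of_mem_𝔮 (S.lie_mem_𝔮_of_𝔨_𝔮 (S.cmpK_mem U) (S.sndQ_mem V)),
    S.projK_of_mem_𝔮 (S.lie_mem_𝔮_of_𝔮_𝔨 (S.sndQ_mem U) (S.cmpK_mem V)),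
    S.projK_of_mem (S.𝔨.lie_mem (S.cmpK_mem U) (S.cmpK_mem V))]
  abel

theorem bracketCompl_eq : S.M.bracketCompl U V = S.M.toCompl ⁅(U : 𝔥 × 𝔥), (V : 𝔥 × 𝔥)⁆ := rfl

theorem fstQ_bracketCompl : S.fstQ (S.M.bracketCompl U V) =
    ⁅S.fstQ U, S.cmpK V⁆ + ⁅S.cmpK U, S.fstQ V⁆ := by
  rw [bracketCompl_eq, toCompl_eq, fstQ_complMk]
  exact S.projQ_lie_fst U V

theorem sndQ_bracketCompl : S.sndQ (S.M.bracketCompl U V) =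
    -⁅S.sndQ U, S.cmpK V⁆ - ⁅S.cmpK U, S.sndQ V⁆ := by
  rw [bracketCompl_eq, toCompl_eq, sndQ_complMk]
  exact S.projQ_lie_snd U V

/-- No `[𝔨, 𝔨]` term survives: the bracket of `(Z, -Z)` and `(W, -W)` is diagonal, hence lies in the
isotropy algebra. -/
theorem cmpK_bracketCompl : S.cmpK (S.M.bracketCompl U V) =
    (1 / 2 : ℝ) • (⁅S.fstQ U, S.fstQ V⁆ - ⁅S.sndQ U, S.sndQ V⁆) := by
  rw [bracketCompl_eq, toCompl_eq, cmpK_complMk]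
  change (1 / 2 : ℝ) • (S.projK ⁅U.1.1, V.1.1⁆ - S.projK ⁅U.1.2, V.1.2⁆) = _
  rw [projK_lie_fst, projK_lie_snd]
  congr 1
  abel

theorem toIsotropy_lie : (S.M.toIsotropy ⁅(U : 𝔥 × 𝔥), (V : 𝔥 × 𝔥)⁆ : 𝔥 × 𝔥) =
    ((1 / 2 : ℝ) • (⁅S.fstQ U, S.fstQ V⁆ + ⁅S.sndQ U, S.sndQ V⁆) + ⁅S.cmpK U, S.cmpK V⁆,
      (1 / 2 : ℝ) • (⁅S.fstQ U, S.fstQ V⁆ + ⁅S.sndQ U, S.sndQ V⁆) + ⁅S.cmpK U, S.cmpK V⁆) := by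
  rw [toIsotropy_eq]
  have h : (1 / 2 : ℝ) • (S.projK ⁅U.1.1, V.1.1⁆ + S.projK ⁅U.1.2, V.1.2⁆) =
      (1 / 2 : ℝ) • (⁅S.fstQ U, S.fstQ V⁆ + ⁅S.sndQ U, S.sndQ V⁆) + ⁅S.cmpK U, S.cmpK V⁆ := by
    rw [projK_lie_fst, projK_lie_snd]
    module
  exact Prod.ext h h

theorem isotropyRep_fst (Z : S.M.isotropy.toSubmodule) :
    S.fstQ (S.M.isotropyRep Z V) = ⁅Z.1.1, S.fstQ V⁆ := by
  rw [fstQ_apply, fstQ_apply, ← S.projQ_lie (S.mem_Δ𝔨.1 Z.2).1]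
  rfl

theorem isotropyRep_snd (Z : S.M.isotropy.toSubmodule) :
    S.sndQ (S.M.isotropyRep Z V) = ⁅Z.1.1, S.sndQ V⁆ := by
  rw [sndQ_apply, sndQ_apply, ← S.projQ_lie (S.mem_Δ𝔨.1 Z.2).1, ← (S.mem_Δ𝔨.1 Z.2).2]
  rfl

theorem isotropyRep_cmpK (Z : S.M.isotropy.toSubmodule) :
    S.cmpK (S.M.isotropyRep Z V) = ⁅Z.1.1, S.cmpK V⁆ := by
  rw [cmpK_apply, cmpK_apply, ← S.projK_lie (S.mem_Δ𝔨.1 Z.2).1]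
  rfl

theorem bracketIsotropy_eq : S.M.bracketIsotropy U V W =
    S.M.isotropyRep (S.M.toIsotropy ⁅(U : 𝔥 × 𝔥), (V : 𝔥 × 𝔥)⁆) W := rfl

theorem fstQ_bracketIsotropy : S.fstQ (S.M.bracketIsotropy U V W) =
    ⁅(1 / 2 : ℝ) • (⁅S.fstQ U, S.fstQ V⁆ + ⁅S.sndQ U, S.sndQ V⁆) + ⁅S.cmpK U, S.cmpK V⁆,
      S.fstQ W⁆ := by
  rw [bracketIsotropy_eq, isotropyRep_fst, toIsotropy_lie]

theorem sndQ_bracketIsotropy : S.sndQ (S.M.bracketIsotropy U V W) =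
    ⁅(1 / 2 : ℝ) • (⁅S.fstQ U, S.fstQ V⁆ + ⁅S.sndQ U, S.sndQ V⁆) + ⁅S.cmpK U, S.cmpK V⁆,
      S.sndQ W⁆ := by
  rw [bracketIsotropy_eq, isotropyRep_snd, toIsotropy_lie]

theorem cmpK_bracketIsotropy : S.cmpK (S.M.bracketIsotropy U V W) =
    ⁅(1 / 2 : ℝ) • (⁅S.fstQ U, S.fstQ V⁆ + ⁅S.sndQ U, S.sndQ V⁆) + ⁅S.cmpK U, S.cmpK V⁆,
      S.cmpK W⁆ := by
  rw [bracketIsotropy_eq, isotropyRep_cmpK, toIsotropy_lie]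

end brackets

end SymmetricPair

/-! ### The Levi-Civita connection -/

theorem ReductiveSpace.InvariantMetric.form_sharp {𝔤 : Type*} [LieRing 𝔤] [LieAlgebra ℝ 𝔤]
    [FiniteDimensional ℝ 𝔤] {R : ReductiveSpace 𝔤} (g : R.InvariantMetric)
    (φ : Module.Dual ℝ R.compl) (X : R.compl) : g.form (g.sharp φ) X = φ X :=
  LinearMap.BilinForm.apply_toDual_symm_apply (hB := g.nondegenerate) φ X

theorem ReductiveSpace.InvariantMetric.eq_of_form {𝔤 : Type*} [LieRing 𝔤] [LieAlgebra ℝ 𝔤]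
    {R : ReductiveSpace 𝔤} (g : R.InvariantMetric)
    {X Y : R.compl} (h : ∀ W, g.form X W = g.form Y W) : X = Y := by
  rw [← sub_eq_zero]
  refine g.nondegenerate.1 _ fun W => ?_
  rw [map_sub, LinearMap.sub_apply, h, sub_self]

/-- Non-degeneracy makes the solution of the Koszul formula unique, so a proposed connection only
has to be checked. -/
theorem ReductiveSpace.InvariantMetric.leviCivita_eq {𝔤 : Type*} [LieRing 𝔤] [LieAlgebra ℝ 𝔤]
    [FiniteDimensional ℝ 𝔤] {R : ReductiveSpace 𝔤} (g : R.InvariantMetric) {X Y N : R.compl}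
    (h : ∀ W, 2 * g.form N W = g.form (R.bracketCompl X Y) W + g.form (R.bracketCompl W X) Y
      + g.form X (R.bracketCompl W Y)) : g.leviCivita X Y = N := by
  refine g.eq_of_form fun W => ?_
  have h1 : g.leviCivita X Y = (1 / 2 : ℝ) • g.sharp (g.koszul X Y) := rfl
  have h2 : g.koszul X Y W = g.form (R.bracketCompl X Y) W + g.form (R.bracketCompl W X) Y
      + g.form X (R.bracketCompl W Y) := rfl
  rw [h1, map_smul, LinearMap.smul_apply, form_sharp, h2, ← h W, smul_eq_mul]
  ring

/-- The determinant `x₁ x₂ - x₄²`. -/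
def detM4 (x : Fin 4 → ℝ) : ℝ := x 0 * x 1 - x 3 ^ 2

theorem MemM4.detM4_pos {x : Fin 4 → ℝ} (hx : MemM4 x) : 0 < detM4 x := sub_pos.2 hx.2.2.2

/-- An entry of the matrix `A` with `Λ_Z (X ⊗ v) = [Z, X] ⊗ A v`, `Z ∈ 𝔭₃`,
`X ⊗ v ∈ 𝔮 ⊗ ℝ² = 𝔭₁ ⊕ 𝔭₂`. -/
noncomputable def lcCoeff₁₁ (x : Fin 4 → ℝ) : ℝ := x 1 * (x 0 - x 2 / 2) / detM4 x
/-- An entry of the matrix `A`, see `lcCoeff₁₁`. -/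
noncomputable def lcCoeff₁₂ (x : Fin 4 → ℝ) : ℝ := x 3 * (x 1 - x 2 / 2) / detM4 x
/-- An entry of the matrix `A`, see `lcCoeff₁₁`. -/
noncomputable def lcCoeff₂₁ (x : Fin 4 → ℝ) : ℝ := -(x 3 * (x 0 - x 2 / 2) / detM4 x)
/-- An entry of the matrix `A`, see `lcCoeff₁₁`. -/
noncomputable def lcCoeff₂₂ (x : Fin 4 → ℝ) : ℝ := -(x 0 * (x 1 - x 2 / 2) / detM4 x)
/-- The coefficient of `[X₁, Y₂] - [X₂, Y₁]` in the `𝔭₃`-component of the connection. -/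
noncomputable def lcCoeffK (x : Fin 4 → ℝ) : ℝ := x 3 / (2 * x 2)

namespace SymmetricPair

variable {𝔥 : Type*} [LieRing 𝔥] [LieAlgebra ℝ 𝔥] [FiniteDimensional ℝ 𝔥] (S : SymmetricPair 𝔥)

theorem formM4_eq (x : Fin 4 → ℝ) (U V : S.M.compl) : S.formM4 x U V =
    x 0 * S.negB (S.fstQ U) (S.fstQ V) + x 1 * S.negB (S.sndQ U) (S.sndQ V)
    + x 3 * (S.negB (S.fstQ U) (S.sndQ V) + S.negB (S.sndQ U) (S.fstQ V))
    + 2 * x 2 * S.negB (S.cmpK U) (S.cmpK V) := rfl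

/-- The connection `Λ_U V` of the metric `(x₁, x₂, x₃, x₄)`. -/
noncomputable def connection (x : Fin 4 → ℝ) (U V : S.M.compl) : S.M.compl :=
  S.complMk
    (lcCoeff₁₁ x • ⁅S.cmpK U, S.fstQ V⁆ + lcCoeff₁₂ x • ⁅S.cmpK U, S.sndQ V⁆
      -- The shifts by `-1` here and by `+1` in the second component come from vanishing torsion,
      -- `Λ_U V - Λ_V U = [U, V]_𝔭`; the signs differ because `𝔭₃` acts through `Z` on one factor
      -- and `-Z` on the other.
      + (lcCoeff₁₁ x - 1) • ⁅S.cmpK V, S.fstQ U⁆ + lcCoeff₁₂ x • ⁅S.cmpK V, S.sndQ U⁆)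
    (lcCoeff₂₁ x • ⁅S.cmpK U, S.fstQ V⁆ + lcCoeff₂₂ x • ⁅S.cmpK U, S.sndQ V⁆
      + lcCoeff₂₁ x • ⁅S.cmpK V, S.fstQ U⁆ + (lcCoeff₂₂ x + 1) • ⁅S.cmpK V, S.sndQ U⁆)
    ((1 / 4 : ℝ) • (⁅S.fstQ U, S.fstQ V⁆ - ⁅S.sndQ U, S.sndQ V⁆)
      + lcCoeffK x • (⁅S.fstQ U, S.sndQ V⁆ - ⁅S.sndQ U, S.fstQ V⁆))
    (by
      have h1 := S.lie_mem_𝔮_of_𝔨_𝔮 (S.cmpK_mem U) (S.fstQ_mem V)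
      have h2 := S.lie_mem_𝔮_of_𝔨_𝔮 (S.cmpK_mem U) (S.sndQ_mem V)
      have h3 := S.lie_mem_𝔮_of_𝔨_𝔮 (S.cmpK_mem V) (S.fstQ_mem U)
      have h4 := S.lie_mem_𝔮_of_𝔨_𝔮 (S.cmpK_mem V) (S.sndQ_mem U)
      exact add_mem (add_mem (add_mem (S.𝔮.smul_mem _ h1) (S.𝔮.smul_mem _ h2))
        (S.𝔮.smul_mem _ h3)) (S.𝔮.smul_mem _ h4))
    (by
      have h1 := S.lie_mem_𝔮_of_𝔨_𝔮 (S.cmpK_mem U) (S.fstQ_mem V)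
      have h2 := S.lie_mem_𝔮_of_𝔨_𝔮 (S.cmpK_mem U) (S.sndQ_mem V)
      have h3 := S.lie_mem_𝔮_of_𝔨_𝔮 (S.cmpK_mem V) (S.fstQ_mem U)
      have h4 := S.lie_mem_𝔮_of_𝔨_𝔮 (S.cmpK_mem V) (S.sndQ_mem U)
      exact add_mem (add_mem (add_mem (S.𝔮.smul_mem _ h1) (S.𝔮.smul_mem _ h2))
        (S.𝔮.smul_mem _ h3)) (S.𝔮.smul_mem _ h4))
    (by
      have h1 := S.lie_mem_𝔨_of_𝔮_𝔮 (S.fstQ_mem U) (S.fstQ_mem V)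
      have h2 := S.lie_mem_𝔨_of_𝔮_𝔮 (S.sndQ_mem U) (S.sndQ_mem V)
      have h3 := S.lie_mem_𝔨_of_𝔮_𝔮 (S.fstQ_mem U) (S.sndQ_mem V)
      have h4 := S.lie_mem_𝔨_of_𝔮_𝔮 (S.sndQ_mem U) (S.fstQ_mem V)
      exact add_mem (S.𝔨.smul_mem _ (sub_mem h1 h2)) (S.𝔨.smul_mem _ (sub_mem h3 h4)))

/-- The trilinear form `-B([X, Y], Z)` is alternating. The five permutations bring each such term to
a fixed order of its arguments. -/
theorem negB_lie_perm (X Y Z : 𝔥) :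
    S.negB ⁅Y, X⁆ Z = -S.negB ⁅X, Y⁆ Z ∧ S.negB ⁅Y, Z⁆ X = S.negB ⁅X, Y⁆ Z ∧
    S.negB ⁅Z, Y⁆ X = -S.negB ⁅X, Y⁆ Z ∧ S.negB ⁅Z, X⁆ Y = S.negB ⁅X, Y⁆ Z ∧
    S.negB ⁅X, Z⁆ Y = -S.negB ⁅X, Y⁆ Z := by
  have h1 : ∀ X Y Z, S.negB ⁅Y, X⁆ Z = -S.negB ⁅X, Y⁆ Z := fun X Y Z => by
    rw [← lie_skew, map_neg, LinearMap.neg_apply]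
  have h2 : S.negB ⁅X, Z⁆ Y = -S.negB ⁅X, Y⁆ Z := by
    rw [negB_lie, negB_symm]
  have h3 : S.negB ⁅Y, Z⁆ X = S.negB ⁅X, Y⁆ Z := by
    rw [negB_lie, negB_symm, h1 X Y, neg_neg]
  exact ⟨h1 _ _ _, h3, by rw [h1, h3], by rw [h1, h2, neg_neg], h2⟩

theorem leviCivita_metric (x : Fin 4 → ℝ) (hx : MemM4 x) (U V : S.M.compl) :
    (S.metric x hx).leviCivita U V = S.connection x U V := by
  refine (S.metric x hx).leviCivita_eq fun T => ?_
  change 2 * S.formM4 x _ _ = S.formM4 x _ _ + S.formM4 x _ _ + S.formM4 x _ _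
  simp only [formM4_eq, connection, fstQ_complMk, sndQ_complMk, cmpK_complMk, fstQ_bracketCompl,
    sndQ_bracketCompl, cmpK_bracketCompl]
  generalize S.fstQ U = X₁
  generalize S.sndQ U = X₂
  generalize S.cmpK U = Z
  generalize S.fstQ V = Y₁
  generalize S.sndQ V = Y₂
  generalize S.cmpK V = W
  generalize S.fstQ T = T₁
  generalize S.sndQ T = T₂
  generalize S.cmpK T = C
  have hr : ∀ X Y Z : 𝔥, S.negB X ⁅Y, Z⁆ = S.negB ⁅X, Y⁆ Z := fun X Y Z => by
    rw [negB_symm, (S.negB_lie_perm X Y Z).2.1]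
  simp only [hr, map_add, map_sub, map_neg, map_smul, LinearMap.add_apply, LinearMap.sub_apply,
    LinearMap.neg_apply, LinearMap.smul_apply, smul_eq_mul]
  have hperm : ∀ X Y Z, S.negB ⁅Y, X⁆ Z = -S.negB ⁅X, Y⁆ Z ∧ S.negB ⁅Y, Z⁆ X = S.negB ⁅X, Y⁆ Z ∧
    S.negB ⁅Z, Y⁆ X = -S.negB ⁅X, Y⁆ Z ∧ S.negB ⁅Z, X⁆ Y = S.negB ⁅X, Y⁆ Z ∧
    S.negB ⁅X, Z⁆ Y = -S.negB ⁅X, Y⁆ Z := S.negB_lie_perm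
  -- Both sides of the Koszul formula are combinations of these twelve trilinear values; after
  -- normalisation only an identity between their coefficients is left.
  simp only [hperm Z Y₁ T₁, hperm Z Y₁ T₂, hperm Z Y₂ T₁, hperm Z Y₂ T₂, hperm W X₁ T₁,
    hperm W X₁ T₂, hperm W X₂ T₁, hperm W X₂ T₂, hperm X₁ Y₁ C, hperm X₁ Y₂ C, hperm X₂ Y₁ C,
    hperm X₂ Y₂ C]
  have hΔ : x 0 * x 1 - x 3 ^ 2 ≠ 0 := hx.detM4_pos.ne'
  have h2 : x 2 ≠ 0 := hx.2.2.1.ne'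
  simp only [lcCoeff₁₁, lcCoeff₁₂, lcCoeff₂₁, lcCoeff₂₂, lcCoeffK, detM4]
  field_simp
  ring

theorem fstQ_leviCivita (x : Fin 4 → ℝ) (hx : MemM4 x) (U V : S.M.compl) :
    S.fstQ ((S.metric x hx).leviCivita U V) =
      lcCoeff₁₁ x • ⁅S.cmpK U, S.fstQ V⁆ + lcCoeff₁₂ x • ⁅S.cmpK U, S.sndQ V⁆
      + (lcCoeff₁₁ x - 1) • ⁅S.cmpK V, S.fstQ U⁆ + lcCoeff₁₂ x • ⁅S.cmpK V, S.sndQ U⁆ := by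
  rw [leviCivita_metric, connection, fstQ_complMk]

theorem sndQ_leviCivita (x : Fin 4 → ℝ) (hx : MemM4 x) (U V : S.M.compl) :
    S.sndQ ((S.metric x hx).leviCivita U V) =
      lcCoeff₂₁ x • ⁅S.cmpK U, S.fstQ V⁆ + lcCoeff₂₂ x • ⁅S.cmpK U, S.sndQ V⁆
      + lcCoeff₂₁ x • ⁅S.cmpK V, S.fstQ U⁆ + (lcCoeff₂₂ x + 1) • ⁅S.cmpK V, S.sndQ U⁆ := by
  rw [leviCivita_metric, connection, sndQ_complMk]

theorem cmpK_leviCivita (x : Fin 4 → ℝ) (hx : MemM4 x) (U V : S.M.compl) :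
    S.cmpK ((S.metric x hx).leviCivita U V) =
      (1 / 4 : ℝ) • (⁅S.fstQ U, S.fstQ V⁆ - ⁅S.sndQ U, S.sndQ V⁆)
      + lcCoeffK x • (⁅S.fstQ U, S.sndQ V⁆ - ⁅S.sndQ U, S.fstQ V⁆) := by
  rw [leviCivita_metric, connection, cmpK_complMk]

end SymmetricPair

/-! ### The Ricci tensor -/

/-- The coefficient of `-B(X₁, Y₁)` in the Ricci tensor. -/
noncomputable def ricCoeff₁₁ (x : Fin 4 → ℝ) : ℝ :=
  lcCoeff₁₁ x / 4 + 1 / 4 - lcCoeffK x * lcCoeff₂₁ x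
/-- The coefficient of `-B(X₁, Y₂) - B(X₂, Y₁)` in the Ricci tensor. -/
noncomputable def ricCoeff₁₂ (x : Fin 4 → ℝ) : ℝ :=
  lcCoeffK x * (lcCoeff₁₁ x - lcCoeff₂₂ x) / 2 + (lcCoeff₁₂ x - lcCoeff₂₁ x) / 8
/-- The coefficient of `-B(X₂, Y₂)` in the Ricci tensor. -/
noncomputable def ricCoeff₂₂ (x : Fin 4 → ℝ) : ℝ :=
  lcCoeffK x * lcCoeff₁₂ x - lcCoeff₂₂ x / 4 + 1 / 4
/-- The coefficient of `-B_𝔥 + B_𝔨` in the `𝔭₃`-part of the Ricci tensor. -/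
noncomputable def ricCoeffK (x : Fin 4 → ℝ) : ℝ :=
  (lcCoeff₁₁ x - 1) ^ 2 + 2 * lcCoeff₁₂ x * lcCoeff₂₁ x + (lcCoeff₂₂ x + 1) ^ 2

namespace SymmetricPair

variable {𝔥 : Type*} [LieRing 𝔥] [LieAlgebra ℝ 𝔥] [FiniteDimensional ℝ 𝔥] (S : SymmetricPair 𝔥)

theorem negB_lie_self (X E : 𝔥) : S.negB ⁅X, E⁆ E = 0 := by
  have h := S.negB_lie X E E
  rw [S.negB_symm E] at h
  linarith

/-- This and the next two lemmas reduce each double bracket in a trace to `⁅E, X⁆` paired with `⁅E,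
Y⁆` up to sign, the shape to which the Casimir sums apply. -/
theorem negB_lie_lie_right (X Y E : 𝔥) : S.negB ⁅X, ⁅Y, E⁆⁆ E = -S.negB ⁅E, X⁆ ⁅E, Y⁆ := by
  rw [negB_lie, negB_symm, negB_lie_lie_swap]

theorem negB_lie_lie_middle (X Y E : 𝔥) : S.negB ⁅X, ⁅E, Y⁆⁆ E = S.negB ⁅E, X⁆ ⁅E, Y⁆ := by
  have h := S.negB_lie_lie_right X Y E
  rw [← lie_skew Y E, lie_neg, map_neg, LinearMap.neg_apply] at h
  linarith

theorem negB_lie_lie_left (X Y E : 𝔥) : S.negB ⁅⁅E, Y⁆, X⁆ E = -S.negB ⁅E, X⁆ ⁅E, Y⁆ := by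
  rw [← lie_skew, map_neg, LinearMap.neg_apply, negB_lie_lie_middle]

theorem casK_symm (Z W : 𝔥) : S.casK Z W = S.casK W Z :=
  Finset.sum_congr rfl fun _ _ => S.negB_symm _ _

theorem casK_zero : S.casK 0 0 = 0 := by simp [casK]

/-- In the adapted basis the trace of the curvature is a combination of Casimir sums. Those with an
argument in `𝔮` are half of `-B`. Those with both arguments in `𝔨` are `casK` for the sum over `𝔨`
and `-B` minus `casK` for the sum over `𝔮`. -/
theorem ricci_apply (x : Fin 4 → ℝ) (hx : MemM4 x) (U V : S.M.compl) :
    (S.metric x hx).ricci U V =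
      ricCoeff₁₁ x * S.negB (S.fstQ U) (S.fstQ V)
      + ricCoeff₁₂ x * (S.negB (S.fstQ U) (S.sndQ V) + S.negB (S.sndQ U) (S.fstQ V))
      + ricCoeff₂₂ x * S.negB (S.sndQ U) (S.sndQ V)
      + S.casK (S.cmpK U) (S.cmpK V)
      + ricCoeffK x * (S.negB (S.cmpK U) (S.cmpK V) - S.casK (S.cmpK U) (S.cmpK V)) := by
  have h : (S.metric x hx).ricci U V =
      LinearMap.trace ℝ S.M.compl (((S.metric x hx).curvature.flip U).flip V) := rfl
  rw [h, trace_compl]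
  simp only [LinearMap.flip_apply, ReductiveSpace.InvariantMetric.curvature_apply, map_sub,
    fstQ_leviCivita, sndQ_leviCivita, cmpK_leviCivita, fstQ_bracketCompl, sndQ_bracketCompl,
    cmpK_bracketCompl, fstQ_bracketIsotropy, sndQ_bracketIsotropy, cmpK_bracketIsotropy,
    fstQ_e₁, sndQ_e₁, cmpK_e₁, fstQ_e₂, sndQ_e₂, cmpK_e₂, fstQ_e₃, sndQ_e₃, cmpK_e₃]
  have hX₁ := S.fstQ_mem U
  have hX₂ := S.sndQ_mem U
  have hY₁ := S.fstQ_mem V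
  have hY₂ := S.sndQ_mem V
  generalize S.fstQ U = X₁ at *
  generalize S.sndQ U = X₂ at *
  generalize S.cmpK U = Z
  generalize S.fstQ V = Y₁ at *
  generalize S.sndQ V = Y₂ at *
  generalize S.cmpK V = W
  simp only [zero_lie, lie_zero, smul_zero, add_zero, zero_add, sub_zero, zero_sub, neg_zero,
    lie_add, add_lie, sub_lie, lie_neg, neg_lie, smul_lie, lie_smul, map_add, map_sub,
    map_neg, map_smul, LinearMap.add_apply, LinearMap.sub_apply, LinearMap.neg_apply,
    LinearMap.smul_apply, smul_eq_mul, negB_lie_self, negB_lie_lie_right, negB_lie_lie_middle,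
    negB_lie_lie_left, mul_zero, map_zero]
  simp only [Finset.sum_add_distrib, Finset.sum_sub_distrib, Finset.sum_neg_distrib,
    ← Finset.mul_sum]
  simp only [S.sum_eQ_lie_lie hX₁, S.sum_eQ_lie_lie hX₂, S.sum_eQ_lie_lie hY₁,
    S.sum_eQ_lie_lie hY₂, S.sum_eK_lie_lie hX₁, S.sum_eK_lie_lie hX₂, S.sum_eK_lie_lie hY₁,
    S.sum_eK_lie_lie hY₂, S.sum_eQ_lie_lie_of_𝔨 W Z, S.sum_eQ_lie_lie_of_𝔨 Z W,
    sum_eK_lie_lie_eq_casK, S.negB_symm Y₁, S.negB_symm Y₂, S.negB_symm W Z, S.casK_symm W Z]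
  simp only [ricCoeff₁₁, ricCoeff₁₂, ricCoeff₂₂, ricCoeffK]
  ring

/-! ### The scalar curvature and the volume -/

theorem formM4_sharp_ricci (x : Fin 4 → ℝ) (hx : MemM4 x) (U V : S.M.compl) :
    S.formM4 x (((S.metric x hx).sharp ∘ₗ (S.metric x hx).ricci) U) V
      = (S.metric x hx).ricci U V :=
  (S.metric x hx).form_sharp _ V

end SymmetricPair

/-- The scalar curvature as a function of `n = dim 𝔮`, `d = dim 𝔨` and the parameters. -/
noncomputable def scalM4 (n d : ℝ) (x : Fin 4 → ℝ) : ℝ :=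
  n * ((x 0 + x 1) / (2 * detM4 x) - x 2 / (8 * detM4 x)
    - x 2 * (x 0 - x 1) ^ 2 / (16 * detM4 x ^ 2) - x 0 * x 1 / (2 * x 2 * detM4 x)
    + 1 / (4 * x 2)) + d / (2 * x 2)

namespace SymmetricPair

variable {𝔥 : Type*} [LieRing 𝔥] [LieAlgebra ℝ 𝔥] [FiniteDimensional ℝ 𝔥] (S : SymmetricPair 𝔥)

/-- Raising an index means inverting the matrix with rows `(x₁, x₄)` and `(x₄, x₂)` on the `𝔮`-part
and dividing by `2 x₃` on `𝔭₃`. The form `casK` enters only through its trace `sum_casK`, so the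
result depends on the dimensions alone. -/
theorem scalarCurvature_metric (x : Fin 4 → ℝ) (hx : MemM4 x) :
    (S.metric x hx).scalarCurvature =
      scalM4 (Module.finrank ℝ S.𝔮) (Module.finrank ℝ S.𝔨) x := by
  have hΔ : detM4 x ≠ 0 := hx.detM4_pos.ne'
  have h2 : x 2 ≠ 0 := hx.2.2.1.ne'
  rw [ReductiveSpace.InvariantMetric.scalarCurvature, trace_compl]
  have hT := S.formM4_sharp_ricci x hx
  -- From here on the Ricci endomorphism is used only through `g(T U, V) = ric(U, V)`; testing on
  -- basis vectors gives linear systems solved by Cramer's rule.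
  generalize (S.metric x hx).sharp ∘ₗ (S.metric x hx).ricci = T at hT
  simp only [formM4_eq, ricci_apply] at hT
  have h1 : ∀ i, S.negB (S.fstQ (T (S.e₁ i))) (S.eQ i) =
      (x 1 * ricCoeff₁₁ x - x 3 * ricCoeff₁₂ x) / detM4 x := by
    intro i
    have ha := hT (S.e₁ i) (S.e₁ i)
    have hb := hT (S.e₁ i) (S.e₂ i)
    simp only [fstQ_e₁, sndQ_e₁, cmpK_e₁, fstQ_e₂, sndQ_e₂, cmpK_e₂, map_zero,
      LinearMap.zero_apply, S.negB_eQ_eQ, if_true, casK_zero] at ha hb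
    rw [eq_div_iff hΔ, detM4]
    linear_combination x 1 * ha - x 3 * hb
  have h2' : ∀ i, S.negB (S.sndQ (T (S.e₂ i))) (S.eQ i) =
      (x 0 * ricCoeff₂₂ x - x 3 * ricCoeff₁₂ x) / detM4 x := by
    intro i
    have ha := hT (S.e₂ i) (S.e₁ i)
    have hb := hT (S.e₂ i) (S.e₂ i)
    simp only [fstQ_e₁, sndQ_e₁, cmpK_e₁, fstQ_e₂, sndQ_e₂, cmpK_e₂, map_zero,
      LinearMap.zero_apply, S.negB_eQ_eQ, if_true, casK_zero] at ha hb
    rw [eq_div_iff hΔ, detM4]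
    linear_combination x 0 * hb - x 3 * ha
  have h3 : ∀ i, S.negB (S.cmpK (T (S.e₃ i))) (S.eK i) =
      (ricCoeffK x + (1 - ricCoeffK x) * S.casK (S.eK i) (S.eK i)) / (2 * x 2) := by
    intro i
    have ha := hT (S.e₃ i) (S.e₃ i)
    simp only [fstQ_e₃, sndQ_e₃, cmpK_e₃, map_zero, S.negB_eK_eK, if_true] at ha
    rw [eq_div_iff (mul_ne_zero two_ne_zero h2)]
    linear_combination ha
  simp only [h1, h2', h3]
  rw [← Finset.sum_div _ _ (2 * x 2), Finset.sum_add_distrib, ← Finset.mul_sum, sum_casK]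
  simp only [Finset.sum_const, Finset.card_univ, Fintype.card_fin, nsmul_eq_mul]
  generalize (Module.finrank ℝ S.𝔮 : ℝ) = n
  generalize (Module.finrank ℝ S.𝔨 : ℝ) = d
  simp only [scalM4, ricCoeff₁₁, ricCoeff₁₂, ricCoeff₂₂, ricCoeffK, lcCoeff₁₁, lcCoeff₁₂,
    lcCoeff₂₁, lcCoeff₂₂, lcCoeffK]
  have hD : detM4 x = x 0 * x 1 - x 3 ^ 2 := rfl
  clear hT h1 h2' h3
  generalize detM4 x = D at *
  field_simp
  rw [hD]
  ring

theorem scal_eq {x : Fin 4 → ℝ} (hx : MemM4 x) :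
    S.scal x = scalM4 (Module.finrank ℝ S.𝔮) (Module.finrank ℝ S.𝔨) x := by
  rw [scal, dif_pos hx, scalarCurvature_metric]

/-- In the adapted basis the metric is a two by two matrix tensored with the identity of `𝔮`, plus
the scalar `x₃` on `𝔨`; the factor `2` on `𝔭₃` cancels against the same factor in the standard
metric. -/
theorem detRel_metric (x : Fin 4 → ℝ) (hx : MemM4 x) :
    S.standardMetric.detRel (S.metric x hx) =
      detM4 x ^ Module.finrank ℝ S.𝔮 * x 2 ^ Module.finrank ℝ S.𝔨 := by
  have hT : ∀ U V, S.formM4 ![1, 1, 1, 0] ((S.standardMetric.sharp ∘ₗ (S.metric x hx).form) U) V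
      = S.formM4 x U V := fun U V => S.standardMetric.form_sharp _ V
  rw [ReductiveSpace.InvariantMetric.detRel]
  generalize S.standardMetric.sharp ∘ₗ (S.metric x hx).form = T at hT
  have h1 : ∀ U i, S.negB (S.fstQ (T U)) (S.eQ i) =
      x 0 * S.negB (S.fstQ U) (S.eQ i) + x 3 * S.negB (S.sndQ U) (S.eQ i) := by
    intro U i
    simpa [formM4_eq] using hT U (S.e₁ i)
  have h2 : ∀ U i, S.negB (S.sndQ (T U)) (S.eQ i) =
      x 3 * S.negB (S.fstQ U) (S.eQ i) + x 1 * S.negB (S.sndQ U) (S.eQ i) := by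
    intro U i
    have h := hT U (S.e₂ i)
    simp [formM4_eq] at h
    linarith
  have h3 : ∀ U i, S.negB (S.cmpK (T U)) (S.eK i) = x 2 * S.negB (S.cmpK U) (S.eK i) := by
    intro U i
    have h := hT U (S.e₃ i)
    simp [formM4_eq] at h
    linarith
  have hM : LinearMap.toMatrix S.basisCompl S.basisCompl T =
      Matrix.fromBlocks (Matrix.fromBlocks (Matrix.diagonal fun _ => x 0)
        (Matrix.diagonal fun _ => x 3) (Matrix.diagonal fun _ => x 3)
        (Matrix.diagonal fun _ => x 1)) 0 0 (Matrix.diagonal fun _ => x 2) := by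
    ext i j
    rw [LinearMap.toMatrix_apply]
    rcases i with (i | i) | i <;> rcases j with (j | j) | j <;>
    simp [basisCompl_inl_inl, basisCompl_inl_inr, basisCompl_inr, basisCompl_repr_inl_inl,
      basisCompl_repr_inl_inr, basisCompl_repr_inr, h1, h2, h3, negB_eQ_eQ, negB_eK_eK,
      Matrix.diagonal_apply, eq_comm]
  rw [← LinearMap.det_toMatrix S.basisCompl, hM, Matrix.det_fromBlocks_zero₂₁,
    Matrix.det_diagonal]
  -- The Schur complement formula needs an invertible upper left block, here `x₁` times the
  -- identity.
  have h0 : x 0 ≠ 0 := hx.1.ne'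
  let : Invertible (fun _ : Fin (Module.finrank ℝ S.𝔮) => x 0) :=
    ⟨fun _ => (x 0)⁻¹, funext fun _ => inv_mul_cancel₀ h0, funext fun _ => mul_inv_cancel₀ h0⟩
  let := Matrix.diagonalInvertible (fun _ : Fin (Module.finrank ℝ S.𝔮) => x 0)
  rw [Matrix.det_fromBlocks₁₁, Matrix.invOf_diagonal_eq, Matrix.diagonal_mul_diagonal,
    Matrix.diagonal_mul_diagonal, Matrix.diagonal_sub, Matrix.det_diagonal, Matrix.det_diagonal]
  have h4 : ∀ i, (⅟(fun _ : Fin (Module.finrank ℝ S.𝔮) => x 0)) i = (x 0)⁻¹ := fun _ => rfl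
  simp only [h4, Finset.prod_const, Finset.card_univ, Fintype.card_fin]
  rw [← mul_pow]
  congr 2
  rw [detM4]
  field_simp

end SymmetricPair

/-! ### The coindex in an orthogonal basis -/

/-- Sylvester's law of inertia: in an orthogonal basis the form is a weighted sum of squares, and
the number of positive weights is the maximal dimension of a positive definite subspace. -/
theorem hasCoindex_of_orthogonal_basis {V ι : Type*} [AddCommGroup V] [Module ℝ V] [Fintype ι]
    (Q : LinearMap.BilinForm ℝ V) (hs : ∀ x y, Q x y = Q y x) (b : Module.Basis ι ℝ V)
    (ho : ∀ i j, i ≠ j → Q (b i) (b j) = 0) :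
    HasCoindex Q {i | 0 < Q (b i) (b i)}.ncard := by
  classical
  have : FiniteDimensional ℝ V := b.finiteDimensional_of_finite
  let q : QuadraticForm ℝ V := Q.toQuadraticMap
  have hq : QuadraticMap.associated (R := ℝ) q = Q :=
    QuadraticMap.associated_left_inverse ℝ hs
  have h1 : q.basisRepr b = QuadraticMap.weightedSumSquares ℝ fun i => Q (b i) (b i) := by
    refine QuadraticMap.basisRepr_eq_of_iIsOrtho q b ?_
    rw [hq]
    intro i j hij
    exact ho i j hij
  have h2 : QuadraticMap.Equivalent q
      (QuadraticMap.weightedSumSquares ℝ fun i => Q (b i) (b i)) := by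
    rw [← h1]
    exact ⟨q.isometryEquivBasisRepr b⟩
  rw [← QuadraticForm.sigPos_of_equiv_weightedSumSquares h2]
  have h3 := sigPos_isGreatest q
  refine ⟨?_, fun k hk => h3.2 ?_⟩
  · obtain ⟨W, hW, hp⟩ := h3.1
    exact ⟨W, hW, fun w hw h0 => hp ⟨w, hw⟩ (by simpa using h0)⟩
  · obtain ⟨W, hW, hp⟩ := hk
    exact ⟨W, hW, fun w h0 => hp w w.2 (by simpa using h0)⟩

/-! ### Second order jets of functions of one variable -/

/-- `f` has the second order Taylor data `f(0) = a`, `f'(0) = b`, `f''(0) = c`. -/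
def HasJet (f : ℝ → ℝ) (a b c : ℝ) : Prop :=
  ∃ f' : ℝ → ℝ, (∀ᶠ t in 𝓝 0, HasDerivAt f (f' t) t) ∧ f 0 = a ∧ f' 0 = b ∧ HasDerivAt f' c 0

namespace HasJet

variable {f g : ℝ → ℝ} {a b c a' b' c' : ℝ}

theorem hasDerivAt (h : HasJet f a b c) : HasDerivAt f b 0 := by
  obtain ⟨f', h1, -, h3, -⟩ := h
  exact h3 ▸ h1.self_of_nhds

theorem deriv_eventuallyEq {f' : ℝ → ℝ} (h : ∀ᶠ t in 𝓝 0, HasDerivAt f (f' t) t) :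
    deriv f =ᶠ[𝓝 0] f' := h.mono fun _ ht => ht.deriv

theorem iteratedDeriv_two (h : HasJet f a b c) : iteratedDeriv 2 f 0 = c := by
  obtain ⟨f', h1, -, -, h4⟩ := h
  rw [iteratedDeriv_succ, iteratedDeriv_one, (deriv_eventuallyEq h1).deriv_eq, h4.deriv]

theorem congr_fun (h : HasJet f a b c) (hg : g =ᶠ[𝓝 0] f) : HasJet g a b c := by
  obtain ⟨f', h1, h2, h3, h4⟩ := h
  refine ⟨f', ?_, hg.self_of_nhds.trans h2, h3, h4⟩
  filter_upwards [h1, hg.eventually_nhds] with t ht hgt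
  exact ht.congr_of_eventuallyEq hgt

theorem congr_jet (h : HasJet f a b c) (ha : a = a') (hb : b = b') (hc : c = c') :
    HasJet f a' b' c' := by
  subst ha hb hc
  exact h

/-- Used to identify Fréchet derivatives, which enter through the chain rule, with values computed
by the product, quotient and logarithm rules. -/
theorem unique (h : HasJet f a b c) (h' : HasJet f a' b' c') : a = a' ∧ b = b' ∧ c = c' := by
  refine ⟨?_, h.hasDerivAt.unique h'.hasDerivAt, h.iteratedDeriv_two ▸ h'.iteratedDeriv_two⟩
  obtain ⟨_, -, h2, -⟩ := h
  obtain ⟨_, -, h2', -⟩ := h'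
  exact h2.symm.trans h2'

theorem const (a : ℝ) : HasJet (fun _ => a) a 0 0 :=
  ⟨fun _ => 0, Eventually.of_forall fun t => hasDerivAt_const t a, rfl, rfl, hasDerivAt_const 0 _⟩

theorem affine (a b : ℝ) : HasJet (fun t => a + t * b) a b 0 :=
  ⟨fun _ => b, Eventually.of_forall fun t => by
    simpa using ((hasDerivAt_id t).mul_const b).const_add a, by simp, rfl, hasDerivAt_const 0 _⟩

theorem add (hf : HasJet f a b c) (hg : HasJet g a' b' c') :
    HasJet (fun t => f t + g t) (a + a') (b + b') (c + c') := by
  obtain ⟨f', h1, h2, h3, h4⟩ := hf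
  obtain ⟨g', k1, k2, k3, k4⟩ := hg
  refine ⟨fun t => f' t + g' t, ?_, by simp only [h2, k2], by simp only [h3, k3], h4.fun_add k4⟩
  filter_upwards [h1, k1] with t ht kt
  exact ht.fun_add kt

theorem neg (hf : HasJet f a b c) : HasJet (fun t => -f t) (-a) (-b) (-c) := by
  obtain ⟨f', h1, h2, h3, h4⟩ := hf
  exact ⟨fun t => -f' t, h1.mono fun _ ht => ht.fun_neg, by simp only [h2], by simp only [h3],
    h4.fun_neg⟩

theorem sub (hf : HasJet f a b c) (hg : HasJet g a' b' c') :
    HasJet (fun t => f t - g t) (a - a') (b - b') (c - c') := by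
  simpa only [sub_eq_add_neg] using hf.add hg.neg

theorem mul (hf : HasJet f a b c) (hg : HasJet g a' b' c') :
    HasJet (fun t => f t * g t) (a * a') (b * a' + a * b') (c * a' + 2 * b * b' + a * c') := by
  have hf0 := hf.hasDerivAt
  have hg0 := hg.hasDerivAt
  obtain ⟨f', h1, h2, h3, h4⟩ := hf
  obtain ⟨g', k1, k2, k3, k4⟩ := hg
  refine ⟨fun t => f' t * g t + f t * g' t, ?_, by simp only [h2, k2],
    by simp only [h2, h3, k2, k3], ?_⟩
  · filter_upwards [h1, k1] with t ht kt
    exact ht.fun_mul kt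
  · refine ((h4.fun_mul hg0).fun_add (hf0.fun_mul k4)).congr_deriv ?_
    rw [h2, h3, k2, k3]
    ring

theorem inv (hf : HasJet f a b c) (ha : a ≠ 0) :
    HasJet (fun t => (f t)⁻¹) a⁻¹ (-b / a ^ 2) (2 * b ^ 2 / a ^ 3 - c / a ^ 2) := by
  have hf0 := hf.hasDerivAt
  obtain ⟨f', h1, h2, h3, h4⟩ := hf
  have hne : f 0 ≠ 0 := h2 ▸ ha
  refine ⟨fun t => -f' t / f t ^ 2, ?_, by simp only [h2], by simp only [h2, h3], ?_⟩
  · filter_upwards [h1, hf0.continuousAt.eventually_ne hne] with t ht kt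
    exact ht.fun_inv kt
  · refine (h4.fun_neg.fun_div (hf0.fun_pow 2) (pow_ne_zero 2 hne)).congr_deriv ?_
    rw [h2, h3]
    field_simp
    push_cast
    ring

theorem div (hf : HasJet f a b c) (hg : HasJet g a' b' c') (ha : a' ≠ 0) :
    HasJet (fun t => f t / g t) (a / a') ((b - a / a' * b') / a')
      ((c - 2 * b * b' / a' + a * (2 * b' ^ 2 / a' ^ 2 - c' / a')) / a') := by
  simp only [div_eq_mul_inv (f _)]
  refine (hf.mul (hg.inv ha)).congr_jet (div_eq_mul_inv _ _).symm ?_ ?_ <;>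
  · field_simp
    try ring

theorem log (hf : HasJet f a b c) (ha : a ≠ 0) :
    HasJet (fun t => Real.log (f t)) (Real.log a) (b / a) (c / a - b ^ 2 / a ^ 2) := by
  have hf0 := hf.hasDerivAt
  obtain ⟨f', h1, h2, h3, h4⟩ := hf
  have hne : f 0 ≠ 0 := h2 ▸ ha
  refine ⟨fun t => f' t / f t, ?_, by simp only [h2], by simp only [h2, h3], ?_⟩
  · filter_upwards [h1, hf0.continuousAt.eventually_ne hne] with t ht kt
    exact ht.log kt
  · refine (h4.fun_div hf0 hne).congr_deriv ?_
    rw [h2, h3]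
    field_simp

/-- The second order chain rule for a function along a curve. -/
theorem comp_curve {E : Type*} [NormedAddCommGroup E] [NormedSpace ℝ E] {F : E → ℝ} {γ : ℝ → E}
    {x T : E} (hF : ContDiffAt ℝ 2 F x) (hγ : ContDiffAt ℝ 2 γ 0) (h0 : γ 0 = x)
    (hT : HasDerivAt γ T 0) :
    HasJet (fun t => F (γ t)) (F x) (fderiv ℝ F x T)
      (fderiv ℝ (fderiv ℝ F) x T T + fderiv ℝ F x (deriv (deriv γ) 0)) := by
  subst h0
  have e1 : ∀ᶠ t in 𝓝 0, DifferentiableAt ℝ γ t :=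
    (hγ.eventually (by simp)).mono fun t ht => ht.differentiableAt (by simp)
  have e2 : ∀ᶠ t in 𝓝 0, DifferentiableAt ℝ F (γ t) :=
    hγ.continuousAt.eventually
      ((hF.eventually (by simp)).mono fun t ht => ht.differentiableAt (by simp))
  have e3 : DifferentiableAt ℝ (deriv γ) 0 :=
    ((hγ.fderiv_right (m := 1) (by norm_num)).clm_apply contDiffAt_const).differentiableAt
      (by simp)
  have e4 : DifferentiableAt ℝ (fderiv ℝ F) (γ 0) :=
    (hF.fderiv_right (m := 1) (by norm_num)).differentiableAt (by simp)
  refine ⟨fun t => fderiv ℝ F (γ t) (deriv γ t), ?_, rfl, by simp only [hT.deriv], ?_⟩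
  · filter_upwards [e1, e2] with t h1 h2
    exact h2.hasFDerivAt.comp_hasDerivAt t h1.hasDerivAt
  · refine ((e4.hasFDerivAt.comp_hasDerivAt (0 : ℝ) hT).clm_apply e3.hasDerivAt).congr_deriv ?_
    rw [hT.deriv]
    rfl

/-- The second order Taylor data of a function along a straight line. -/
theorem comp_line {E : Type*} [NormedAddCommGroup E] [NormedSpace ℝ E] {F : E → ℝ}
    {x : E} (hF : ContDiffAt ℝ 2 F x) (T : E) :
    HasJet (fun t => F (x + t • T)) (F x) (fderiv ℝ F x T)
      (fderiv ℝ (fderiv ℝ F) x T T) := by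
  have hd : ∀ t : ℝ, HasDerivAt (fun t : ℝ => x + t • T) T t := fun t => by
    simpa using ((hasDerivAt_id t).smul_const T).const_add x
  have h2 : deriv (fun t : ℝ => x + t • T) = fun _ => T := funext fun t => (hd t).deriv
  refine (comp_curve (γ := fun t : ℝ => x + t • T) hF (by fun_prop) (by simp)
    (hd 0)).congr_jet rfl rfl ?_
  rw [h2]
  simp

end HasJet

/-! ### The scalar curvature and the volume as functions of the parameters -/

/-- The function `n log (x₁ x₂ - x₄²) + d log x₃`, twice the logarithm of the volume relative to
the standard metric. -/
noncomputable def volM4 (n d : ℝ) (x : Fin 4 → ℝ) : ℝ :=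
  n * Real.log (detM4 x) + d * Real.log (x 2)

/-- The Lagrange function of the scalar curvature on metrics of fixed volume. -/
noncomputable def lagM4 (n d l : ℝ) (x : Fin 4 → ℝ) : ℝ := scalM4 n d x - l * volM4 n d x

theorem two_le_infty : (2 : WithTop ℕ∞) ≤ ∞ := ENat.LEInfty.out

theorem contDiff_detM4 : ContDiff ℝ ∞ detM4 := by
  unfold detM4
  fun_prop

theorem isOpen_memM4 : IsOpen {x | MemM4 x} := by
  have h : ∀ i, IsOpen {x : Fin 4 → ℝ | 0 < x i} := fun i =>
    isOpen_lt continuous_const (continuous_apply i)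
  exact (h 0).inter ((h 1).inter ((h 2).inter (isOpen_lt
    (f := fun x : Fin 4 → ℝ => x 3 ^ 2) (g := fun x => x 0 * x 1) (by fun_prop) (by fun_prop))))

theorem MemM4.eventually {x : Fin 4 → ℝ} (hx : MemM4 x) : ∀ᶠ y in 𝓝 x, MemM4 y :=
  isOpen_memM4.eventually_mem hx

theorem MemM4.smul {x : Fin 4 → ℝ} (hx : MemM4 x) {c : ℝ} (hc : 0 < c) : MemM4 (c • x) := by
  obtain ⟨h0, h1, h2, h3⟩ := hx
  refine ⟨mul_pos hc h0, mul_pos hc h1, mul_pos hc h2, ?_⟩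
  simp only [Pi.smul_apply, smul_eq_mul]
  nlinarith [mul_lt_mul_of_pos_left h3 (pow_pos hc 2)]

section smooth

variable {x : Fin 4 → ℝ} (hx : MemM4 x) (n d l : ℝ)
include hx

theorem contDiffAt_scalM4 : ContDiffAt ℝ ∞ (scalM4 n d) x := by
  have h1 := hx.detM4_pos.ne'
  have h2 := hx.2.2.1.ne'
  have h3 : ContDiffAt ℝ ∞ detM4 x := contDiff_detM4.contDiffAt
  unfold scalM4
  refine ContDiffAt.add (contDiffAt_const.mul (ContDiffAt.add (ContDiffAt.sub (ContDiffAt.sub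
    (ContDiffAt.sub (ContDiffAt.div ?_ ?_ ?_) (ContDiffAt.div ?_ ?_ ?_))
    (ContDiffAt.div ?_ ?_ ?_)) (ContDiffAt.div ?_ ?_ ?_)) (ContDiffAt.div ?_ ?_ ?_)))
    (ContDiffAt.div ?_ ?_ ?_) <;> first | fun_prop | simp [h1, h2]

theorem contDiffAt_volM4 : ContDiffAt ℝ ∞ (volM4 n d) x := by
  have h1 := hx.detM4_pos.ne'
  have h2 := hx.2.2.1.ne'
  have h3 : ContDiffAt ℝ ∞ detM4 x := contDiff_detM4.contDiffAt
  unfold volM4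
  exact (contDiffAt_const.mul (h3.log h1)).add
    (contDiffAt_const.mul (ContDiffAt.log (by fun_prop) h2))

theorem contDiffAt_lagM4 : ContDiffAt ℝ ∞ (lagM4 n d l) x :=
  (contDiffAt_scalM4 hx n d).sub (contDiffAt_const.mul (contDiffAt_volM4 hx n d))

/-- Logarithmic homogeneity, used to rescale a metric, or a whole line of metrics, to unit volume.
-/
theorem volM4_smul {c : ℝ} (hc : 0 < c) :
    volM4 n d (c • x) = (2 * n + d) * Real.log c + volM4 n d x := by
  have h1 := hx.detM4_pos.ne'
  have h2 := hx.2.2.1.ne'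
  have h : detM4 (c • x) = c ^ 2 * detM4 x := by
    simp only [detM4, Pi.smul_apply, smul_eq_mul]
    ring
  rw [volM4, h, Pi.smul_apply, smul_eq_mul, Real.log_mul (by positivity) h1,
    Real.log_mul hc.ne' h2, Real.log_pow, volM4]
  push_cast
  ring

/-- The derivative of `volM4`. -/
theorem fderiv_volM4 (T : Fin 4 → ℝ) : fderiv ℝ (volM4 n d) x T =
    n * ((x 1 * T 0 + x 0 * T 1 - 2 * x 3 * T 3) / detM4 x) + d * (T 2 / x 2) := by
  have h1 := hx.detM4_pos.ne'
  have h2 := hx.2.2.1.ne'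
  have hj := HasJet.comp_line ((contDiffAt_volM4 hx n d).of_le (two_le_infty)) T
  have ha : ∀ i, HasJet (fun t => (x + t • T) i) (x i) (T i) 0 := fun i =>
    HasJet.affine (x i) (T i)
  have hD := ((ha 0).mul (ha 1)).sub ((ha 3).mul (ha 3))
  have hD' : HasJet (fun t => detM4 (x + t • T)) (detM4 x)
      (x 1 * T 0 + x 0 * T 1 - 2 * x 3 * T 3) (2 * (T 0 * T 1 - T 3 ^ 2)) := by
    refine (hD.congr_fun (Eventually.of_forall fun t => ?_)).congr_jet ?_ ?_ ?_
    · simp only [detM4]; ring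
    · simp only [detM4]; ring
    · ring
    · ring
  exact (hj.unique (((HasJet.const n).mul (hD'.log h1)).add
    ((HasJet.const d).mul ((ha 2).log h2)))).2.1.trans (by ring)

end smooth

/-! ### Unit volume metrics, their tangent spaces and the Lagrange multiplier criterion. -/

namespace SymmetricPair

variable {𝔥 : Type*} [LieRing 𝔥] [LieAlgebra ℝ 𝔥] [FiniteDimensional ℝ 𝔥] (S : SymmetricPair 𝔥)

/-- The dimension of `𝔮`. -/
noncomputable def dimQ : ℝ := Module.finrank ℝ S.𝔮

/-- The dimension of `𝔨`. -/
noncomputable def dimK : ℝ := Module.finrank ℝ S.𝔨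

theorem scal_eq_scalM4 {x : Fin 4 → ℝ} (hx : MemM4 x) : S.scal x = scalM4 S.dimQ S.dimK x :=
  S.scal_eq hx

theorem dimQ_pos : 0 < S.dimQ := by
  obtain ⟨X, hX⟩ := S.nontrivial
  have h : S.projQ X ≠ 0 := by
    intro h
    rw [projQ_apply, smul_eq_zero] at h
    exact hX (sub_eq_zero.1 (h.resolve_left (by norm_num))).symm
  have : Nontrivial S.𝔮 := ⟨⟨⟨S.projQ X, S.projQ_mem X⟩, 0, by simpa using h⟩⟩
  exact Nat.cast_pos.2 Module.finrank_pos

theorem sum_casK_eq : ∑ i, S.casK (S.eK i) (S.eK i) = S.dimK - S.dimQ / 2 := S.sum_casK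

/-- The trace of `casK` is a sum of squared norms, so `dim 𝔨 ≥ dim 𝔮 / 2 > 0`. -/
theorem dimK_pos : 0 < S.dimK := by
  have h : 0 ≤ ∑ i, S.casK (S.eK i) (S.eK i) :=
    Finset.sum_nonneg fun i _ => Finset.sum_nonneg fun j _ => S.negB_nonneg _
  rw [sum_casK_eq] at h
  linarith [S.dimQ_pos]

/-- Logarithms replace the volume condition by a level set of the smooth function `volM4`. -/
theorem mem_unitM4 {V₀ : ℝ} (hV₀ : 0 < V₀) {x : Fin 4 → ℝ} :
    x ∈ S.unitM4 V₀ ↔ MemM4 x ∧ volM4 S.dimQ S.dimK x = -2 * Real.log V₀ := by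
  refine and_congr_right fun hx => ?_
  have h1 := hx.detM4_pos
  have h2 := hx.2.2.1
  rw [volume, dif_pos hx, detRel_metric]
  have h3 : 0 < detM4 x ^ Module.finrank ℝ S.𝔮 * x 2 ^ Module.finrank ℝ S.𝔨 := by positivity
  have h4 : 0 < V₀ * √(detM4 x ^ Module.finrank ℝ S.𝔮 * x 2 ^ Module.finrank ℝ S.𝔨) := by
    positivity
  have h5 : Real.log (V₀ * √(detM4 x ^ Module.finrank ℝ S.𝔮 * x 2 ^ Module.finrank ℝ S.𝔨)) =
      Real.log V₀ + volM4 S.dimQ S.dimK x / 2 := by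
    rw [Real.log_mul hV₀.ne' (by positivity), Real.log_sqrt h3.le,
      Real.log_mul (by positivity) (by positivity), Real.log_pow, Real.log_pow]
    rfl
  constructor
  · intro h
    rw [h, Real.log_one] at h5
    linarith
  · intro h
    rw [h] at h5
    refine Real.eq_one_of_pos_of_log_eq_zero h4 ?_
    rw [h5]
    ring

section variation

variable {V₀ : ℝ} (hV₀ : 0 < V₀) {x T : Fin 4 → ℝ} {γ : ℝ → Fin 4 → ℝ}
include hV₀

theorem IsCurve.volM4_eventuallyEq (hγ : S.IsCurve V₀ x T γ) :
    (fun t => volM4 S.dimQ S.dimK (γ t)) =ᶠ[𝓝 0] fun _ => -2 * Real.log V₀ :=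
  hγ.mem.mono fun _ ht => ((S.mem_unitM4 hV₀).1 ht).2

theorem IsCurve.fderiv_volM4_eq_zero (hx : MemM4 x) (hγ : S.IsCurve V₀ x T γ) :
    fderiv ℝ (volM4 S.dimQ S.dimK) x T = 0 := by
  have h := HasJet.comp_curve ((contDiffAt_volM4 hx S.dimQ S.dimK).of_le
    (two_le_infty)) (hγ.smooth.of_le (two_le_infty)) hγ.base hγ.velocity
  exact (h.unique ((HasJet.const _).congr_fun (IsCurve.volM4_eventuallyEq S hV₀ hγ))).2.1

/-- Along a curve of unit volume metrics the scalar curvature is the Lagrange function up to a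
constant. -/
theorem IsCurve.scal_eventuallyEq (hγ : S.IsCurve V₀ x T γ) (l : ℝ) :
    (fun t => S.scal (γ t)) =ᶠ[𝓝 0]
      fun t => lagM4 S.dimQ S.dimK l (γ t) + l * (-2 * Real.log V₀) := by
  filter_upwards [hγ.mem] with t ht
  obtain ⟨h1, h2⟩ := (S.mem_unitM4 hV₀).1 ht
  rw [S.scal_eq_scalM4 h1, lagM4, h2]
  ring

/-- A tangent vector of the level set of the volume is the velocity of a curve. -/
theorem exists_isCurve (hx : x ∈ S.unitM4 V₀)
    (hT : fderiv ℝ (volM4 S.dimQ S.dimK) x T = 0) : ∃ γ, S.IsCurve V₀ x T γ := by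
  obtain ⟨hm, hv⟩ := (S.mem_unitM4 hV₀).1 hx
  have hN : 0 < 2 * S.dimQ + S.dimK := by linarith [S.dimQ_pos, S.dimK_pos]
  set F := volM4 S.dimQ S.dimK with hF
  -- The scaling that returns the line `x + t T` to the level set; `2 n + d` is the degree of
  -- homogeneity. Its derivative at `0` vanishes because `T` is in the kernel, so the velocity
  -- remains `T`.
  let σ : ℝ → ℝ := fun t => Real.exp (-(F (x + t • T) - F x) / (2 * S.dimQ + S.dimK))
  have hFx : ContDiffAt ℝ ∞ F x := contDiffAt_volM4 hm _ _
  have hl : ContDiffAt ℝ ∞ (fun t : ℝ => x + t • T) 0 := by fun_prop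
  have hFl : ContDiffAt ℝ ∞ (fun t : ℝ => F (x + t • T)) 0 :=
    ContDiffAt.comp (0 : ℝ) (g := F) (by simpa using hFx) hl
  have hσ : ContDiffAt ℝ ∞ σ 0 := by
    refine ContDiffAt.exp (ContDiffAt.div_const ?_ _)
    exact (hFl.sub contDiffAt_const).neg
  have hσ0 : σ 0 = 1 := by simp [σ]
  have hσ' : HasDerivAt σ 0 0 := by
    have h1 : HasDerivAt (fun t : ℝ => F (x + t • T)) 0 0 := hT ▸
      (HasJet.comp_line (hFx.of_le (two_le_infty)) T).hasDerivAt
    have h2 := (((h1.sub_const (F x)).fun_neg).div_const (2 * S.dimQ + S.dimK)).exp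
    refine h2.congr_deriv ?_
    simp
  have hlT : HasDerivAt (fun t : ℝ => x + t • T) T 0 := by
    simpa using ((hasDerivAt_id (0 : ℝ)).smul_const T).const_add x
  refine ⟨fun t => σ t • (x + t • T), hσ.smul hl, ?_, by simp [hσ0], ?_⟩
  · have he : ∀ᶠ t : ℝ in 𝓝 0, MemM4 (x + t • T) :=
      hl.continuousAt.eventually (by simpa using hm.eventually)
    filter_upwards [he] with t ht
    have hσt : 0 < σ t := Real.exp_pos _
    refine (S.mem_unitM4 hV₀).2 ⟨ht.smul hσt, ?_⟩
    rw [volM4_smul ht _ _ hσt, ← hv, ← hF]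
    simp only [σ, Real.log_exp]
    field_simp
    ring
  · refine (hσ'.fun_smul hlT).congr_deriv ?_
    simp [hσ0]

/-- Velocities lie in the kernel of the differential of `volM4`, and each kernel vector is a
velocity, so the span adds nothing. -/
theorem mem_tangentSpace (hx : x ∈ S.unitM4 V₀) :
    T ∈ S.tangentSpace V₀ x ↔ fderiv ℝ (volM4 S.dimQ S.dimK) x T = 0 := by
  constructor
  · intro h
    have hle : S.tangentSpace V₀ x ≤
        LinearMap.ker (fderiv ℝ (volM4 S.dimQ S.dimK) x : (Fin 4 → ℝ) →ₗ[ℝ] ℝ) := by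
      refine Submodule.span_le.2 ?_
      rintro T ⟨γ, hγ⟩
      exact IsCurve.fderiv_volM4_eq_zero S hV₀ hx.1 hγ
    exact hle h
  · intro h
    exact Submodule.subset_span (S.exists_isCurve hV₀ hx h)

theorem finrank_tangentSpace (hx : x ∈ S.unitM4 V₀) :
    Module.finrank ℝ (S.tangentSpace V₀ x) = 3 := by
  have h : S.tangentSpace V₀ x =
      LinearMap.ker (fderiv ℝ (volM4 S.dimQ S.dimK) x : (Fin 4 → ℝ) →ₗ[ℝ] ℝ) := by
    ext T
    exact S.mem_tangentSpace hV₀ hx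
  have hne : (fderiv ℝ (volM4 S.dimQ S.dimK) x : (Fin 4 → ℝ) →ₗ[ℝ] ℝ) ≠ 0 := by
    intro h0
    -- The differential is nonzero because its value in the direction `x₃` is `d / x₃`.
    have h1 : fderiv ℝ (volM4 S.dimQ S.dimK) x (Pi.single 2 1) = 0 :=
      congrArg (fun φ : (Fin 4 → ℝ) →ₗ[ℝ] ℝ => φ (Pi.single 2 1)) h0
    rw [fderiv_volM4 hx.1] at h1
    simp [S.dimK_pos.ne', hx.1.2.2.1.ne'] at h1
  have h2 := Module.Dual.finrank_ker_add_one_of_ne_zero hne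
  rw [h]
  simpa using h2

/-- Criterion for a critical point of the scalar curvature on unit volume metrics, in terms of the
Lagrange function and an orthogonal basis of the tangent space for its second derivative. -/
theorem isNondegenerateUnstableEinstein_of_lagM4 (hx : x ∈ S.unitM4 V₀)
    (hE : (S.metric x hx.1).IsEinstein) (l : ℝ)
    (h1 : ∀ T, fderiv ℝ (lagM4 S.dimQ S.dimK l) x T = 0)
    (v : Fin 3 → Fin 4 → ℝ) (hv : LinearIndependent ℝ v)
    (hvT : ∀ i, fderiv ℝ (volM4 S.dimQ S.dimK) x (v i) = 0)
    (ho : ∀ i j, i ≠ j → fderiv ℝ (fderiv ℝ (lagM4 S.dimQ S.dimK l)) x (v i) (v j) = 0)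
    (hne : ∀ i, fderiv ℝ (fderiv ℝ (lagM4 S.dimQ S.dimK l)) x (v i) (v i) ≠ 0)
    (m : ℕ) (hm : m ≠ 0)
    (hpos : {i | 0 < fderiv ℝ (fderiv ℝ (lagM4 S.dimQ S.dimK l)) x (v i) (v i)}.ncard = m) :
    S.IsNondegenerateUnstableEinstein V₀ x m := by
  set L := lagM4 S.dimQ S.dimK l with hL
  have hLc : ContDiffAt ℝ 2 L x := (contDiffAt_lagM4 hx.1 _ _ _).of_le (two_le_infty)
  have hsymm : IsSymmSndFDerivAt ℝ L x := hLc.isSymmSndFDerivAt (by simp)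
  have hjet : ∀ T γ, S.IsCurve V₀ x T γ → HasJet (fun t => S.scal (γ t))
      (L x + l * (-2 * Real.log V₀)) 0 (fderiv ℝ (fderiv ℝ L) x T T) := by
    intro T γ hγ
    have h := HasJet.comp_curve hLc (hγ.smooth.of_le (two_le_infty)) hγ.base
      hγ.velocity
    -- The chain rule also produces the differential of `L` applied to the acceleration of `γ`; it
    -- vanishes because `L` is critical in every direction, not only the tangent ones.
    refine ((h.add (HasJet.const (l * (-2 * Real.log V₀)))).congr_fun
      (IsCurve.scal_eventuallyEq S hV₀ hγ l)).congr_jet rfl ?_ ?_ <;> simp [h1]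
  let q : LinearMap.BilinForm ℝ (Fin 4 → ℝ) := LinearMap.mk₂ ℝ
    (fun u w => fderiv ℝ (fderiv ℝ L) x u w) (by simp) (by simp) (by simp) (by simp)
  let Q : LinearMap.BilinForm ℝ (S.tangentSpace V₀ x) :=
    q.compl₁₂ (S.tangentSpace V₀ x).subtype (S.tangentSpace V₀ x).subtype
  have hQ : ∀ T T', Q T T' = fderiv ℝ (fderiv ℝ L) x T T' := fun _ _ => rfl
  let u : Fin 3 → S.tangentSpace V₀ x := fun i => ⟨v i, (S.mem_tangentSpace hV₀ hx).2 (hvT i)⟩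
  have hu : LinearIndependent ℝ u :=
    LinearIndependent.of_comp (S.tangentSpace V₀ x).subtype hv
  let b := basisOfLinearIndependentOfCardEqFinrank hu
    (by rw [S.finrank_tangentSpace hV₀ hx, Fintype.card_fin])
  have hb : ∀ i, (b i : Fin 4 → ℝ) = v i := fun i => by simp [b, u]
  have hs : ∀ T T', Q T T' = Q T' T := fun T T' => hsymm T T'
  have ho' : ∀ i j, i ≠ j → Q (b i) (b j) = 0 := fun i j hij => by
    rw [hQ, hb, hb, ho i j hij]
  refine ⟨hx, ⟨hx.1, hE⟩, ⟨hx, fun T γ hγ => (hjet T γ hγ).hasDerivAt⟩, Q, ⟨hs, fun T => ?_,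
    fun T γ hγ => ⟨?_, (hjet T γ hγ).iteratedDeriv_two⟩⟩, ?_, ?_, ?_⟩
  · exact S.exists_isCurve hV₀ hx ((S.mem_tangentSpace hV₀ hx).1 T.2)
  · refine ContDiffAt.congr_of_eventuallyEq ?_ (IsCurve.scal_eventuallyEq S hV₀ hγ l)
    refine ContDiffAt.add (ContDiffAt.comp (0 : ℝ) (g := L) ?_ (hγ.smooth.of_le (two_le_infty)))
      contDiffAt_const
    rw [hγ.base]
    exact hLc
  · refine LinearMap.IsOrthoᵢ.nondegenerate_of_not_isOrtho_basis_self b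
      (fun i j hij => ho' i j hij) fun i h => hne i ?_
    rw [← hb, ← hQ]
    exact h
  · obtain ⟨i, hi⟩ := Set.nonempty_of_ncard_ne_zero (hpos ▸ hm)
    refine ⟨b i, ?_⟩
    rw [hQ, hb]
    exact hi
  · have h := hasCoindex_of_orthogonal_basis Q hs b ho'
    simp only [hQ, hb] at h
    rwa [hpos] at h

end variation

/-- Some positive multiple of every metric has unit volume. -/
theorem exists_smul_mem_unitM4 {V₀ : ℝ} (hV₀ : 0 < V₀) {x : Fin 4 → ℝ} (hx : MemM4 x) :
    ∃ c : ℝ, 0 < c ∧ c • x ∈ S.unitM4 V₀ := by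
  have hN : 0 < 2 * S.dimQ + S.dimK := by linarith [S.dimQ_pos, S.dimK_pos]
  refine ⟨Real.exp ((-2 * Real.log V₀ - volM4 S.dimQ S.dimK x) / (2 * S.dimQ + S.dimK)),
    Real.exp_pos _, (S.mem_unitM4 hV₀).2 ⟨hx.smul (Real.exp_pos _), ?_⟩⟩
  rw [volM4_smul hx _ _ (Real.exp_pos _), Real.log_exp]
  field_simp
  ring

/-- Criterion for a critical point of the scalar curvature on unit volume metrics, in terms of the
second order Taylor expansions of the Lagrange function along straight lines. -/
theorem isNondegenerateUnstableEinstein_of_hasJet {V₀ : ℝ} (hV₀ : 0 < V₀) {x : Fin 4 → ℝ}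
    (hx : x ∈ S.unitM4 V₀) (hE : (S.metric x hx.1).IsEinstein) (l : ℝ) (h : (Fin 4 → ℝ) → ℝ)
    (hjet : ∀ T, ∃ a, HasJet (fun t => lagM4 S.dimQ S.dimK l (x + t • T)) a 0 (h T))
    (v : Fin 3 → Fin 4 → ℝ) (hvT : ∀ i, fderiv ℝ (volM4 S.dimQ S.dimK) x (v i) = 0)
    (ho : ∀ i j, i < j → h (v i + v j) = h (v i) + h (v j)) (hne : ∀ i, h (v i) ≠ 0)
    (m : ℕ) (hm : m ≠ 0) (hpos : {i | 0 < h (v i)}.ncard = m) :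
    S.IsNondegenerateUnstableEinstein V₀ x m := by
  set L := lagM4 S.dimQ S.dimK l with hL
  have hLc : ContDiffAt ℝ 2 L x := (contDiffAt_lagM4 hx.1 _ _ _).of_le two_le_infty
  have h1 : ∀ T, fderiv ℝ L x T = 0 := fun T =>
    ((HasJet.comp_line hLc T).unique (hjet T).choose_spec).2.1
  have h2 : ∀ T, fderiv ℝ (fderiv ℝ L) x T T = h T := fun T =>
    ((HasJet.comp_line hLc T).unique (hjet T).choose_spec).2.2
  have hsymm : IsSymmSndFDerivAt ℝ L x := hLc.isSymmSndFDerivAt (by simp)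
  have h3 : ∀ i j, i < j → fderiv ℝ (fderiv ℝ L) x (v i) (v j) = 0 := by
    intro i j hij
    -- Polarisation: the additivity `ho` of the quadratic form and symmetry give orthogonality.
    have e1 := h2 (v i + v j)
    rw [ho i j hij, ← h2, ← h2] at e1
    simp only [map_add, add_apply] at e1
    rw [hsymm (v j) (v i)] at e1
    linarith
  have h4 : ∀ i j, i ≠ j → fderiv ℝ (fderiv ℝ L) x (v i) (v j) = 0 := by
    intro i j hij
    rcases lt_or_gt_of_ne hij with hlt | hlt
    · exact h3 i j hlt
    · rw [hsymm]
      exact h3 j i hlt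
  -- Pairwise orthogonal vectors with nonzero values of the form are independent, so this needs no
  -- separate check.
  have hv : LinearIndependent ℝ v := by
    rw [Fintype.linearIndependent_iff]
    intro g hg i
    have e1 : fderiv ℝ (fderiv ℝ L) x (v i) (∑ j, g j • v j) = 0 := by rw [hg, map_zero]
    rw [map_sum, Finset.sum_eq_single i (fun j _ hj => by
      rw [map_smul, h4 i j hj.symm, smul_zero]) (by simp), map_smul, h2, smul_eq_mul] at e1
    exact (mul_eq_zero.1 e1).resolve_right (hne i)
  refine S.isNondegenerateUnstableEinstein_of_lagM4 hV₀ hx hE l h1 v hv hvT h4 ?_ m hm ?_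
  · intro i
    rw [h2]
    exact hne i
  · have e1 : {i | 0 < fderiv ℝ (fderiv ℝ L) x (v i) (v i)} = {i | 0 < h (v i)} := by
      simp only [h2]
    exact (congrArg Set.ncard e1).trans hpos

end SymmetricPair

/-! ### Taylor expansions at the two metrics -/

theorem memM4_g5 : MemM4 ![1 / 2, 3 / 2, 1, 1 / 2] := by
  simp only [MemM4, Matrix.cons_val]
  norm_num

theorem memM4_g3 {y : ℝ} (hy : y ^ 2 < 1 / 4) : MemM4 ![1, 1, 1, y] := by
  have : y ^ 2 < 1 := by linarith
  simpa [MemM4] using this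

/-- The multiplier is minus the Einstein constant `1 / (2 c)`, since the differentials of the scalar
curvature and of `volM4` in a direction `h` are `-⟨ric, h⟩` and the `g`-trace of `h`. The power `c ^
3` reflects that scalar curvature has degree `-1`. -/
theorem hasJet_lagM4_g5 (n d : ℝ) {c : ℝ} (hc : 0 < c) (T : Fin 4 → ℝ) :
    ∃ a, HasJet (fun t => lagM4 n d (-(1 / (2 * c))) (c • ![1 / 2, 3 / 2, 1, 1 / 2] + t • T)) a 0
      ((n * (-7 / 2 * T 0 ^ 2 + T 0 * T 1 + 4 * T 0 * T 2 + 2 * T 0 * T 3 + T 1 ^ 2 / 2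
        - 2 * T 1 * T 3 - T 2 ^ 2) + d * T 2 ^ 2 / 2) / c ^ 3) := by
  have ha : ∀ i, HasJet (fun t => (c • (![1 / 2, 3 / 2, 1, 1 / 2] : Fin 4 → ℝ) + t • T) i)
      (c * (![1 / 2, 3 / 2, 1, 1 / 2] : Fin 4 → ℝ) i) (T i) 0 := fun i =>
    HasJet.affine _ (T i)
  have h0 := ha 0
  have h1 := ha 1
  have h2 := ha 2
  have h3 := ha 3
  simp only [Matrix.cons_val] at h0 h1 h2 h3
  have hD : HasJet (fun t => detM4 (c • ![1 / 2, 3 / 2, 1, 1 / 2] + t • T)) (c ^ 2 / 2)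
      (c * (3 / 2 * T 0 + 1 / 2 * T 1 - T 3)) (2 * (T 0 * T 1 - T 3 ^ 2)) := by
    refine ((h0.mul h1).sub (h3.mul h3)).congr_fun (Eventually.of_forall fun t => ?_)
      |>.congr_jet ?_ ?_ ?_
    · simp only [detM4]; ring
    all_goals ring
  have hk : ∀ k : ℝ, HasJet (fun _ => k) k 0 0 := HasJet.const
  have hc0 := hc.ne'
  have hj := ((hk n).mul ((((((h0.add h1).div ((hk 2).mul hD) (by positivity)).sub
    (h2.div ((hk 8).mul hD) (by positivity))).sub
    ((h2.mul ((h0.sub h1).mul (h0.sub h1))).div ((hk 16).mul (hD.mul hD)) (by positivity))).sub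
    ((h0.mul h1).div (((hk 2).mul h2).mul hD) (by positivity))).add
    ((hk 1).div ((hk 4).mul h2) (by positivity)))).add
    ((hk d).div ((hk 2).mul h2) (by positivity)) |>.sub ((hk (-(1 / (2 * c)))).mul
      (((hk n).mul (hD.log (by positivity))).add ((hk d).mul (h2.log (by positivity)))))
  refine ⟨_, (hj.congr_fun (Eventually.of_forall fun t => ?_)).congr_jet rfl ?_ ?_⟩
  · simp only [lagM4, scalM4, volM4, pow_two]
  · field_simp
    ring
  · field_simp
    ring

/-- The second derivative of the Lagrange function at `(1, 1, 1, y)` in the direction `T`. -/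
noncomputable def hessG3 (n d y : ℝ) (T : Fin 4 → ℝ) : ℝ :=
  n * (-(T 0 + T 1) * (T 0 + T 1 - 2 * y * T 3) / (1 - y ^ 2) ^ 2
      + (3 / 8) * (2 * (T 0 + T 1 - 2 * y * T 3) ^ 2 / (1 - y ^ 2) ^ 3
        - 2 * (T 0 * T 1 - T 3 ^ 2) / (1 - y ^ 2) ^ 2)
      + T 2 * (T 0 + T 1 - 2 * y * T 3) / (4 * (1 - y ^ 2) ^ 2)
      - (T 0 - T 1) ^ 2 / (8 * (1 - y ^ 2) ^ 2)
      - (T 0 * T 1 + T 2 ^ 2) / (1 - y ^ 2)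
      + ((T 0 + T 1) * T 2 / (1 - y ^ 2)
        + (T 0 + T 1) * (T 0 + T 1 - 2 * y * T 3) / (1 - y ^ 2) ^ 2
        - T 2 * (T 0 + T 1 - 2 * y * T 3) / (1 - y ^ 2) ^ 2)
      + T 2 ^ 2 / 2) + d * T 2 ^ 2
      + 3 / (8 * (1 - y ^ 2)) * (n * (2 * (T 0 * T 1 - T 3 ^ 2) / (1 - y ^ 2)
        - (T 0 + T 1 - 2 * y * T 3) ^ 2 / (1 - y ^ 2) ^ 2) - d * T 2 ^ 2)

/-- The multiplier is again minus the Einstein constant. The relation `hr` is the trace of the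
Einstein equation on `𝔭₃`; it is needed only for the first derivative. -/
theorem hasJet_lagM4_g3 {n d y c : ℝ} (hc : 0 < c) (hy : y ^ 2 < 1 / 4)
    (hr : n * (1 + 2 * y ^ 2) = d * (1 - 4 * y ^ 2)) (T : Fin 4 → ℝ) :
    ∃ a, HasJet (fun t => lagM4 n d (-(3 / (8 * (1 - y ^ 2) * c))) (c • ![1, 1, 1, y] + t • T)) a 0
      (hessG3 n d y T / c ^ 3) := by
  have ha : ∀ i, HasJet (fun t => (c • ![1, 1, 1, y] + t • T) i)
      (c * ![1, 1, 1, y] i) (T i) 0 := fun i =>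
    HasJet.affine _ (T i)
  have h0 := ha 0
  have h1 := ha 1
  have h2 := ha 2
  have h3 := ha 3
  simp only [Matrix.cons_val] at h0 h1 h2 h3
  have hy1 : 0 < 1 - y ^ 2 := by linarith
  have hD : HasJet (fun t => detM4 (c • ![1, 1, 1, y] + t • T)) (c ^ 2 * (1 - y ^ 2))
      (c * (T 0 + T 1 - 2 * y * T 3)) (2 * (T 0 * T 1 - T 3 ^ 2)) := by
    refine ((h0.mul h1).sub (h3.mul h3)).congr_fun (Eventually.of_forall fun t => ?_)
      |>.congr_jet ?_ ?_ ?_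
    · simp only [detM4]; ring
    all_goals ring
  have hk : ∀ k : ℝ, HasJet (fun _ => k) k 0 0 := HasJet.const
  have hc0 := hc.ne'
  have hj := ((hk n).mul ((((((h0.add h1).div ((hk 2).mul hD) (by positivity)).sub
    (h2.div ((hk 8).mul hD) (by positivity))).sub
    ((h2.mul ((h0.sub h1).mul (h0.sub h1))).div ((hk 16).mul (hD.mul hD)) (by positivity))).sub
    ((h0.mul h1).div (((hk 2).mul h2).mul hD) (by positivity))).add
    ((hk 1).div ((hk 4).mul h2) (by positivity)))).add
    ((hk d).div ((hk 2).mul h2) (by positivity)) |>.sub ((hk (-(3 / (8 * (1 - y ^ 2) * c)))).mul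
      (((hk n).mul (hD.log (by positivity))).add ((hk d).mul (h2.log (by positivity)))))
  refine ⟨_, (hj.congr_fun (Eventually.of_forall fun t => ?_)).congr_jet rfl ?_ ?_⟩
  · simp only [lagM4, scalM4, volM4, pow_two]
  · obtain ⟨D, hD⟩ : ∃ D, D = 1 - y ^ 2 := ⟨_, rfl⟩
    rw [← hD] at hy1 ⊢
    have hr' : 3 * (n + d) = 2 * D * (n + 2 * d) := by rw [hD]; linear_combination hr
    generalize T 0 + T 1 - 2 * y * T 3 = D1
    field_simp
    -- Only the coefficient of `T 2` requires the relation between the dimensions; the number is a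
    -- power of two left by clearing denominators.
    linear_combination 131072 * T 2 * D ^ 2 * hr'
  · rw [hessG3]
    obtain ⟨D, hD⟩ : ∃ D, D = 1 - y ^ 2 := ⟨_, rfl⟩
    rw [← hD] at hy1 ⊢
    generalize T 0 + T 1 - 2 * y * T 3 = D1
    field_simp
    ring

/-! ### The two Einstein metrics -/

namespace SymmetricPair

variable {𝔥 : Type*} [LieRing 𝔥] [LieAlgebra ℝ 𝔥] [FiniteDimensional ℝ 𝔥] (S : SymmetricPair 𝔥)

/-- The Einstein equation for the metric `(x₁, x₂, x₃, x₄)` in terms of the coefficients of its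
Ricci tensor. -/
theorem isEinstein_metric {x : Fin 4 → ℝ} (hx : MemM4 x) (k : ℝ) (h₁ : ricCoeff₁₁ x = k * x 0)
    (h₂ : ricCoeff₂₂ x = k * x 1) (h₃ : ricCoeff₁₂ x = k * x 3)
    (hK : ∀ Z ∈ S.𝔨, ∀ W ∈ S.𝔨, S.casK Z W + ricCoeffK x * (S.negB Z W - S.casK Z W) =
      k * (2 * x 2) * S.negB Z W) : (S.metric x hx).IsEinstein := by
  refine ⟨k, LinearMap.ext₂ fun U V => ?_⟩
  have h := hK _ (S.cmpK_mem U) _ (S.cmpK_mem V)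
  rw [ricci_apply, h₁, h₂, h₃]
  change _ = k * S.formM4 x U V
  rw [formM4_eq]
  linear_combination h

/-- Here `ricCoeffK` equals `1`, so `casK` cancels from the `𝔭₃`-equation and no condition on `B_𝔨`
is needed. -/
theorem isEinstein_g5 {c : ℝ} (hc : 0 < c) (hx : MemM4 (c • ![1 / 2, 3 / 2, 1, 1 / 2])) :
    (S.metric _ hx).IsEinstein := by
  have e0 : (c • ![1 / 2, 3 / 2, 1, 1 / 2] : Fin 4 → ℝ) 0 = c * (1 / 2) := rfl
  have e1 : (c • ![1 / 2, 3 / 2, 1, 1 / 2] : Fin 4 → ℝ) 1 = c * (3 / 2) := rfl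
  have e2 : (c • ![1 / 2, 3 / 2, 1, 1 / 2] : Fin 4 → ℝ) 2 = c * 1 := rfl
  have e3 : (c • ![1 / 2, 3 / 2, 1, 1 / 2] : Fin 4 → ℝ) 3 = c * (1 / 2) := rfl
  have hD : detM4 (c • ![1 / 2, 3 / 2, 1, 1 / 2]) = c ^ 2 / 2 := by
    rw [detM4, e0, e1, e3]; ring
  have hK : ricCoeffK (c • ![1 / 2, 3 / 2, 1, 1 / 2]) = 1 := by
    simp only [ricCoeffK, lcCoeff₁₁, lcCoeff₁₂, lcCoeff₂₁, lcCoeff₂₂, hD, e0, e1, e2, e3]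
    field_simp
    norm_num
  refine S.isEinstein_metric hx (1 / (2 * c)) ?_ ?_ ?_ fun Z _ W _ => ?_
  · simp only [ricCoeff₁₁, lcCoeff₁₁, lcCoeff₂₁, lcCoeffK, hD, e0, e1, e2, e3]
    field_simp
    norm_num
  · simp only [ricCoeff₂₂, lcCoeff₁₂, lcCoeff₂₂, lcCoeffK, hD, e0, e1, e2, e3]
    field_simp
    norm_num
  · simp only [ricCoeff₁₂, lcCoeff₁₁, lcCoeff₁₂, lcCoeff₂₁, lcCoeff₂₂, lcCoeffK, hD, e0, e1, e2, e3]
    field_simp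
    norm_num
  · rw [hK, e2]
    field_simp
    ring

/-- Now `ricCoeffK` is not `1`, so `casK` has to be a multiple of `-B`. The equations on `𝔭₁ ⊕ 𝔭₂`
hold for every such `y`; `ha` is the equation on `𝔭₃`. -/
theorem isEinstein_g3 {a y c : ℝ} (hc : 0 < c) (hy : y ^ 2 < 1 / 4)
    (ha : a * (2 + 4 * y ^ 2) = 8 * y ^ 2 + 1)
    (hK : ∀ Z ∈ S.𝔨, ∀ W ∈ S.𝔨, S.casK Z W = a * S.negB Z W)
    (hx : MemM4 (c • ![1, 1, 1, y])) : (S.metric _ hx).IsEinstein := by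
  have e0 : (c • ![1, 1, 1, y] : Fin 4 → ℝ) 0 = c * 1 := rfl
  have e1 : (c • ![1, 1, 1, y] : Fin 4 → ℝ) 1 = c * 1 := rfl
  have e2 : (c • ![1, 1, 1, y] : Fin 4 → ℝ) 2 = c * 1 := rfl
  have e3 : (c • ![1, 1, 1, y] : Fin 4 → ℝ) 3 = c * y := rfl
  have hy1 : 1 - y ^ 2 ≠ 0 := by linarith
  have hD : detM4 (c • ![1, 1, 1, y]) = c ^ 2 * (1 - y ^ 2) := by
    rw [detM4, e0, e1, e3]; ring
  have hR : ricCoeffK (c • ![1, 1, 1, y]) = (1 - 4 * y ^ 2) / (2 * (1 - y ^ 2)) := by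
    simp only [ricCoeffK, lcCoeff₁₁, lcCoeff₁₂, lcCoeff₂₁, lcCoeff₂₂, hD, e0, e1, e2, e3]
    field_simp
    ring
  refine S.isEinstein_metric hx (3 / (8 * (1 - y ^ 2) * c)) ?_ ?_ ?_ fun Z hZ W hW => ?_
  · simp only [ricCoeff₁₁, lcCoeff₁₁, lcCoeff₂₁, lcCoeffK, hD, e0, e1, e2, e3]
    field_simp
    ring
  · simp only [ricCoeff₂₂, lcCoeff₁₂, lcCoeff₂₂, lcCoeffK, hD, e0, e1, e2, e3]
    field_simp
    ring
  · simp only [ricCoeff₁₂, lcCoeff₁₁, lcCoeff₁₂, lcCoeff₂₁, lcCoeff₂₂, lcCoeffK, hD, e0, e1, e2, e3]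
    field_simp
    ring
  · rw [hR, e2, hK Z hZ W hW]
    have h : a + (1 - 4 * y ^ 2) / (2 * (1 - y ^ 2)) * (1 - a) =
        3 / (8 * (1 - y ^ 2) * c) * (2 * (c * 1)) := by
      field_simp
      linear_combination 4 * ha
    linear_combination S.negB Z W * h

theorem isNondegenerateUnstableEinstein_g5 {V₀ : ℝ} (hV₀ : 0 < V₀) {c : ℝ} (hc : 0 < c)
    (hx : c • ![1 / 2, 3 / 2, 1, 1 / 2] ∈ S.unitM4 V₀) :
    S.IsNondegenerateUnstableEinstein V₀ (c • ![1 / 2, 3 / 2, 1, 1 / 2]) 1 := by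
  have hn := S.dimQ_pos
  have hd := S.dimK_pos
  have e0 : (c • ![1 / 2, 3 / 2, 1, 1 / 2] : Fin 4 → ℝ) 0 = c * (1 / 2) := rfl
  have e1 : (c • ![1 / 2, 3 / 2, 1, 1 / 2] : Fin 4 → ℝ) 1 = c * (3 / 2) := rfl
  have e2 : (c • ![1 / 2, 3 / 2, 1, 1 / 2] : Fin 4 → ℝ) 2 = c * 1 := rfl
  have e3 : (c • ![1 / 2, 3 / 2, 1, 1 / 2] : Fin 4 → ℝ) 3 = c * (1 / 2) := rfl
  have hD : detM4 (c • ![1 / 2, 3 / 2, 1, 1 / 2]) = c ^ 2 / 2 := by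
    rw [detM4, e0, e1, e3]; ring
  -- A basis that diagonalises the Hessian for all dimensions at once. The third vector fixes `x₁`,
  -- `x₃` and, to first order, the determinant; the first two have opposite values.
  let v : Fin 3 → Fin 4 → ℝ := ![![S.dimQ / 2, -(S.dimQ / 2 + S.dimK), S.dimQ, S.dimQ / 2],
    ![S.dimK / 2, S.dimK / 2, -S.dimQ, S.dimK / 2], ![0, 1, 0, 1 / 2]]
  let h : (Fin 4 → ℝ) → ℝ := fun T => (S.dimQ * (-7 / 2 * T 0 ^ 2 + T 0 * T 1 + 4 * T 0 * T 2
    + 2 * T 0 * T 3 + T 1 ^ 2 / 2 - 2 * T 1 * T 3 - T 2 ^ 2) + S.dimK * T 2 ^ 2 / 2) / c ^ 3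
  have h0 : h (v 0) = S.dimQ * (S.dimQ + S.dimK) * (2 * S.dimQ + S.dimK) / 2 / c ^ 3 := by
    simp only [h, v, Matrix.cons_val]
    ring
  have h1 : h (v 1) = -(S.dimQ * (S.dimQ + S.dimK) * (2 * S.dimQ + S.dimK) / 2 / c ^ 3) := by
    simp only [h, v, Matrix.cons_val]
    ring
  have h2 : h (v 2) = -(S.dimQ / 2 / c ^ 3) := by
    simp only [h, v, Matrix.cons_val]
    ring
  have p0 : 0 < h (v 0) := by rw [h0]; positivity
  have p1 : h (v 1) < 0 := by rw [h1, neg_lt_zero]; positivity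
  have p2 : h (v 2) < 0 := by rw [h2, neg_lt_zero]; positivity
  refine S.isNondegenerateUnstableEinstein_of_hasJet hV₀ hx (S.isEinstein_g5 hc hx.1)
    (-(1 / (2 * c))) h (hasJet_lagM4_g5 _ _ hc) v ?_ ?_ ?_ 1 one_ne_zero ?_
  · intro i
    rw [fderiv_volM4 hx.1, hD, e0, e1, e2, e3]
    fin_cases i <;> simp only [v, Matrix.cons_val, Fin.zero_eta, Fin.mk_one, Fin.reduceFinMk] <;>
    · field_simp
      ring
  · intro i j hij
    fin_cases i <;> fin_cases j <;> first | exact absurd hij (by decide) | skip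
    all_goals
      simp only [h, v, Matrix.cons_val, Pi.add_apply, Fin.zero_eta, Fin.mk_one, Fin.reduceFinMk]
      ring
  · intro i
    fin_cases i
    exacts [p0.ne', p1.ne, p2.ne]
  · have e : {i | 0 < h (v i)} = {0} := by
      ext i
      fin_cases i
      · simpa using p0
      · simpa using p1.le
      · simpa using p2.le
    rw [e, Set.ncard_singleton]

theorem isNondegenerateUnstableEinstein_g3 {V₀ : ℝ} (hV₀ : 0 < V₀) {a y c : ℝ} (hc : 0 < c)
    (hy0 : 0 < y) (hy : y ^ 2 < 1 / 4) (ha : a * (2 + 4 * y ^ 2) = 8 * y ^ 2 + 1)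
    (hn : S.dimQ = 2 * (1 - a) * S.dimK)
    (hK : ∀ Z ∈ S.𝔨, ∀ W ∈ S.𝔨, S.casK Z W = a * S.negB Z W)
    (hx : c • ![1, 1, 1, y] ∈ S.unitM4 V₀) :
    S.IsNondegenerateUnstableEinstein V₀ (c • ![1, 1, 1, y]) 2 := by
  have hr : S.dimQ * (1 + 2 * y ^ 2) = S.dimK * (1 - 4 * y ^ 2) := by
    rw [hn]
    linear_combination -S.dimK * ha
  -- Writing both dimensions as multiples of `k` eliminates `a`, and the values of the Hessian
  -- factor in `y`.
  obtain ⟨k, hk⟩ : ∃ k, k = S.dimK / (1 + 2 * y ^ 2) := ⟨_, rfl⟩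
  have hkpos : 0 < k := by
    rw [hk]
    exact div_pos S.dimK_pos (by positivity)
  have hdk : S.dimK = k * (1 + 2 * y ^ 2) := by
    rw [hk]
    field_simp
  have hnk : S.dimQ = k * (1 - 4 * y ^ 2) := by
    rw [hk]
    field_simp
    linarith
  have e0 : (c • ![1, 1, 1, y] : Fin 4 → ℝ) 0 = c * 1 := rfl
  have e1 : (c • ![1, 1, 1, y] : Fin 4 → ℝ) 1 = c * 1 := rfl
  have e2 : (c • ![1, 1, 1, y] : Fin 4 → ℝ) 2 = c * 1 := rfl
  have e3 : (c • ![1, 1, 1, y] : Fin 4 → ℝ) 3 = c * y := rfl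
  have hy1 : 0 < 1 - y ^ 2 := by linarith
  have hD : detM4 (c • ![1, 1, 1, y]) = c ^ 2 * (1 - y ^ 2) := by
    rw [detM4, e0, e1, e3]; ring
  -- Exchanging `x₁` and `x₂` preserves the metric and `scalM4`. The first vector is odd under the
  -- exchange and the other two are even. The second fixes `x₃` and, to first order, the
  -- determinant; the third is the even tangent vector orthogonal to it.
  let v : Fin 3 → Fin 4 → ℝ := ![![1, -1, 0, 0], ![y, y, 0, 1],
    ![2 * y * (1 - 4 * y ^ 2), 2 * y * (1 - 4 * y ^ 2), 2 * y * (1 - 4 * y ^ 2),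
      2 * (1 - 4 * y ^ 2) + (1 + 2 * y ^ 2) * (1 - y ^ 2)]]
  have hy2 : 0 < 1 - 4 * y ^ 2 := by linarith
  have hy3 : 0 < 1 - 2 * y ^ 2 := by linarith
  let h : (Fin 4 → ℝ) → ℝ := fun T => hessG3 S.dimQ S.dimK y T / c ^ 3
  have h0 : h (v 0) = k * (1 - 4 * y ^ 2) * (1 - 2 * y ^ 2) / (2 * (1 - y ^ 2) ^ 2) / c ^ 3 := by
    simp only [h, v, hessG3, Matrix.cons_val, hdk, hnk]
    congr 1
    field_simp
    ring
  have h1 : h (v 1) = -(k * (1 - 4 * y ^ 2) * y ^ 2 / (1 - y ^ 2) / c ^ 3) := by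
    simp only [h, v, hessG3, Matrix.cons_val, hdk, hnk]
    rw [← neg_div]
    congr 1
    field_simp
    ring
  have h2 : h (v 2) = 9 * k * y ^ 2 * (1 - 4 * y ^ 2) * (1 - 2 * y ^ 2) / c ^ 3 := by
    simp only [h, v, hessG3, Matrix.cons_val, hdk, hnk]
    congr 1
    field_simp
    ring
  have p0 : 0 < h (v 0) := by rw [h0]; positivity
  have p1 : h (v 1) < 0 := by rw [h1, neg_lt_zero]; positivity
  have p2 : 0 < h (v 2) := by rw [h2]; positivity
  refine S.isNondegenerateUnstableEinstein_of_hasJet hV₀ hx (S.isEinstein_g3 hc hy ha hK hx.1)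
    (-(3 / (8 * (1 - y ^ 2) * c))) h (hasJet_lagM4_g3 hc hy hr) v ?_ ?_ ?_ 2 two_ne_zero ?_
  · intro i
    rw [fderiv_volM4 hx.1, hD, e0, e1, e2, e3, hdk, hnk]
    fin_cases i <;> simp only [v, Matrix.cons_val, Fin.zero_eta, Fin.mk_one, Fin.reduceFinMk] <;>
    · field_simp
      ring
  · intro i j hij
    fin_cases i <;> fin_cases j <;> first | exact absurd hij (by decide) | skip
    all_goals
      simp only [h, v, hessG3, Matrix.cons_val, Pi.add_apply, Fin.zero_eta, Fin.mk_one,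
        Fin.reduceFinMk, hdk, hnk]
      rw [← add_div]
      congr 1
      field_simp
      ring
  · intro i
    fin_cases i
    exacts [p0.ne', p1.ne, p2.ne']
  · have e : {i | 0 < h (v i)} = {0, 2} := by
      ext i
      fin_cases i
      · simpa using p0
      · simpa using p1.le
      · simpa using p2
    rw [e, Set.ncard_pair (by decide)]

/-- If `B_𝔨 = a B_𝔥` on `𝔨` then `dim 𝔮 = 2 (1 - a) dim 𝔨`. -/
theorem dimQ_eq {a : ℝ} (hK : ∀ Z ∈ S.𝔨, ∀ W ∈ S.𝔨, S.casK Z W = a * S.negB Z W) :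
    S.dimQ = 2 * (1 - a) * S.dimK := by
  have h := S.sum_casK_eq
  have h1 : ∀ i, S.casK (S.eK i) (S.eK i) = a := fun i => by
    rw [hK _ (S.eK_mem i) _ (S.eK_mem i), S.negB_eK_eK, if_pos rfl, mul_one]
  simp only [h1, Finset.sum_const, Finset.card_univ, Fintype.card_fin, nsmul_eq_mul] at h
  change S.dimK * a = _ at h
  linarith

end SymmetricPair

theorem theorem3p3 {𝔥 : Type*} [LieRing 𝔥] [LieAlgebra ℝ 𝔥] [FiniteDimensional ℝ 𝔥]
    (S : SymmetricPair 𝔥) (V₀ : ℝ) (hV₀ : 0 < V₀) :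
    (∃ c : ℝ, 0 < c ∧
      S.IsNondegenerateUnstableEinstein V₀ (c • ![1 / 2, 3 / 2, 1, 1 / 2]) 1) ∧
    ∀ a : ℝ, 1 / 2 < a →
      (∀ Z W : S.𝔨, killingForm ℝ S.𝔨 Z W = a * killingForm ℝ 𝔥 (Z : 𝔥) (W : 𝔥)) →
      ∃ c : ℝ, 0 < c ∧
        S.IsNondegenerateUnstableEinstein V₀
          (c • ![1, 1, 1, 1 / 2 * √((2 * a - 1) / (2 - a))]) 2 := by
  constructor
  · obtain ⟨c, hc, hx⟩ := S.exists_smul_mem_unitM4 hV₀ memM4_g5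
    exact ⟨c, hc, S.isNondegenerateUnstableEinstein_g5 hV₀ hc hx⟩
  · intro a ha hB
    have hK : ∀ Z ∈ S.𝔨, ∀ W ∈ S.𝔨, S.casK Z W = a * S.negB Z W := by
      intro Z hZ W hW
      have h := hB ⟨Z, hZ⟩ ⟨W, hW⟩
      rw [S.killingForm_𝔨] at h
      change S.casK Z W = a * -killingForm ℝ 𝔥 Z W
      linarith
    have hn := S.dimQ_eq hK
    -- From `dim 𝔮 = 2 (1 - a) dim 𝔨` with both dimensions positive. It yields `y ^ 2 < 1 / 4`,
    -- while `a > 1 / 2` yields `y > 0`, without which two of the three Hessian values would vanish.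
    have ha1 : a < 1 := by
      have h1 := S.dimQ_pos
      have h2 := S.dimK_pos
      by_contra! h3
      nlinarith
    set y := 1 / 2 * √((2 * a - 1) / (2 - a)) with hy
    have h2a : 0 < 2 - a := by linarith
    have hq : 0 < (2 * a - 1) / (2 - a) := div_pos (by linarith) h2a
    have hy0 : 0 < y := by positivity
    have hy2 : y ^ 2 = 1 / 4 * ((2 * a - 1) / (2 - a)) := by
      rw [hy, mul_pow, Real.sq_sqrt hq.le]
      norm_num
    have hlt : (2 * a - 1) / (2 - a) < 1 := by
      rw [div_lt_one h2a]
      linarith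
    have hyq : y ^ 2 < 1 / 4 := by linarith
    have hay : a * (2 + 4 * y ^ 2) = 8 * y ^ 2 + 1 := by
      rw [hy2]
      field_simp
      ring
    obtain ⟨c, hc, hx⟩ := S.exists_smul_mem_unitM4 hV₀ (memM4_g3 hyq)
    exact ⟨c, hc, S.isNondegenerateUnstableEinstein_g3 hV₀ hc hy0 hyq hay hn hK hx⟩
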